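/- Let $d\ge 1$, let $E$ be a measurable space with a probability measure $\mu$, and let $h:E^d\to\mathbb R$ be measurable and invariant under permutations of its $d$ arguments. Let $(\gamma_n)_{n\ge1}$ be a sequence of positive reals for which there is a constant $C$ such that $\gamma_n$ is nondecreasing, $\gamma_{2n}\le C\gamma_n$ for all $n\ge 1$, and $$\sum_{k\ge l}\frac{2^{dk}}{\gamma_{2^k}^2}\le C\,\frac{2^{dl}}{\gamma_{2^l}^2}\qquad\text{for all } l=1,2,\dots$$ Let $X_1,X_2,\dots$ be i.i.d. with law $\mu$ and let $\varepsilon_1,\varepsilon_2,\dots$ be i.i.d. random signs with $P(\varepsilon_j=\pm1)=\tfrac12$, independent of $(X_j)$. Let $(X^{(r)}_j)_{1\le r\le d,\,j\ge1}$ be i.i.d. with law $\mu$ and let $(\varepsilon^{(r)}_j)_{1\le r\le d,\,j\ge1}$ be i.i.d. random signs, independent of $(X^{(r)}_j)$. Put $I_n=\{\mathbf i\in\mathbb N^d:1\le i_1<\dots<i_d\le n\}$, $C_n=\{1,\dots,n\}^d$ and, for $\mathbf i=(i_1,\dots,i_d)$, $$X_{\mathbf i}=(X_{i_1},\dots,X_{i_d}),\quad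 \varepsilon_{\mathbf i}=\varepsilon_{i_1}\cdots\varepsilon_{i_d},\quad \tilde X_{\mathbf i}=(X^{(1)}_{i_1},\dots,X^{(d)}_{i_d}),\quad \tilde\varepsilon_{\mathbf i}=\varepsilon^{(1)}_{i_1}\cdots\varepsilon^{(d)}_{i_d}.$$ For $J\subset\{1,\dots,d\}$ and measurable $f\ge0$ on $E^d$, let $E_Jf(x)$ be the integral of $f$ over the coordinates in $J$ with respect to the product of copies of $\mu$, with the coordinates $x_r$, $r\notin J$, kept fixed. For $k=1,2,\dots$ define $A_{k,1}=\{x\in E^d:h^2(x)\le\gamma_{2^k}^2\}$ and, for $l=1,\dots,d-1$, $$A_{k,l+1}=\{x\in A_{k,l}:\ 2^{kl}E_J(h^2 1_{A_{k,l}})(x)\le\gamma_{2^k}^2\ \text{ for all } J\subset\{1,\dots,d\} \text{ with } |J|=l\}.$$ Then the following six conditions are equivalent: 1. $\gamma_n^{-1}\sum_{\mathbf i\in I_n}\varepsilon_{\mathbf i}h(X_{\mathbf i})\to0$ almost surely as $n\to\infty$; 2. $\gamma_n^{-1}\sum_{\mathbf i\in C_n}\tilde\varepsilon_{\mathbf i}h(\tilde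 X_{\mathbf i})\to0$ almost surely; 3. $\gamma_n^{-2}\sum_{\mathbf i\in I_n}h^2(X_{\mathbf i})\to0$ almost surely; 4. $\gamma_n^{-2}\sum_{\mathbf i\in C_n}h^2(\tilde X_{\mathbf i})\to0$ almost surely; 5. $\sum_{k=1}^\infty P(\exists\,\mathbf i\in I_{2^k}:\ X_{\mathbf i}\notin A_{k,d})<\infty$; 6. $\sum_{k=1}^\infty P(\exists\,\mathbf i\in C_{2^k}:\ \tilde X_{\mathbf i}\notin A_{k,d})<\infty$. -/

import Mathlib

open MeasureTheory ProbabilityTheory Filter Topology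

/-- The regularity conditions on the normalizing sequence `γ 1, γ 2, …` of positive reals
(the value `γ 0` is irrelevant): monotonicity, doubling, and the tail-sum condition
`∑_{k ≥ l} 2^{dk} / γ_{2^k}² ≤ C 2^{dl} / γ_{2^l}²` for `l = 1, 2, …`
(in particular the series converges). -/
structure IsRegularNormalizer (d : ℕ) (γ : ℕ → ℝ) (C : ℝ) : Prop where
  pos : ∀ n, 1 ≤ n → 0 < γ n
  mono : ∀ m n, 1 ≤ m → m ≤ n → γ m ≤ γ n
  doubling : ∀ n, 1 ≤ n → γ (2 * n) ≤ C * γ n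
  summable : ∀ l, 1 ≤ l →
    Summable fun j : ℕ => (2 : ℝ) ^ (d * (l + j)) / γ (2 ^ (l + j)) ^ 2
  tail : ∀ l, 1 ≤ l →
    ∑' j : ℕ, (2 : ℝ) ^ (d * (l + j)) / γ (2 ^ (l + j)) ^ 2
      ≤ C * ((2 : ℝ) ^ (d * l) / γ (2 ^ l) ^ 2)

/-- `C_n`: the multi-indices `(i_1, …, i_d)` with `1 ≤ i_r ≤ n` for all `r`. -/
def cubeIndices (d n : ℕ) : Finset (Fin d → ℕ) :=
  Fintype.piFinset fun _ => Finset.Icc 1 n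

open Classical in
/-- `I_n`: the multi-indices with `1 ≤ i_1 < i_2 < ⋯ < i_d ≤ n`. -/
noncomputable def simplexIndices (d n : ℕ) : Finset (Fin d → ℕ) :=
  (cubeIndices d n).filter fun i => StrictMono i

/-- The sets `A_{k,l}`, for `1 ≤ l`:
`A_{k,1} = {h² ≤ γ_{2^k}²}` and
`A_{k,l+1} = {x ∈ A_{k,l} : 2^{kl} E_I (h² 1_{A_{k,l}})(x) ≤ γ_{2^k}² for all I with |I| = l}`,
where `E_I` integrates the coordinates in `I` with respect to the product of copies of `μ`
and keeps the other coordinates of `x`.  The value at `l = 0` is a placeholder. -/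
noncomputable def truncSet {E : Type*} [MeasurableSpace E] {d : ℕ} (μ : Measure E)
    (h : (Fin d → E) → ℝ) (γ : ℕ → ℝ) (k : ℕ) : ℕ → Set (Fin d → E)
  | 0 => Set.univ
  | 1 => {x | h x ^ 2 ≤ γ (2 ^ k) ^ 2}
  | l + 2 => {x | x ∈ truncSet μ h γ k (l + 1) ∧
      ∀ I : Finset (Fin d), I.card = l + 1 →
        (2 : ENNReal) ^ (k * (l + 1)) *
          lmarginal (fun _ : Fin d => μ) I
            ((truncSet μ h γ k (l + 1)).indicator fun y => ENNReal.ofReal (h y ^ 2)) x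
          ≤ ENNReal.ofReal (γ (2 ^ k) ^ 2)}

/-- `X` is an i.i.d. family with common law `μ`, `ε` is a Rademacher family (independent random
signs) over the same index set, and `ε` is independent of `X`. -/
structure IsSymmetrizedSample {Ω E ι : Type*} [MeasurableSpace Ω] [MeasurableSpace E]
    (P : Measure Ω) (μ : Measure E) (X : ι → Ω → E) (ε : ι → Ω → ℝ) : Prop where
  measurable_X : ∀ j, Measurable (X j)
  law_X : ∀ j, P.map (X j) = μ
  indep_X : iIndepFun X P
  measurable_ε : ∀ j, Measurable (ε j)
  prob_one : ∀ j, P {ω | ε j ω = 1} = 1 / 2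
  prob_neg_one : ∀ j, P {ω | ε j ω = -1} = 1 / 2
  indep_ε : iIndepFun ε P
  indep_X_ε : IndepFun (fun ω j => X j ω) (fun ω j => ε j ω) P

/-! Conditions 1 and 2 pass to 3 and 4, these to 6, and 6 gives 5 and 2, while 5 gives 1. Each step
is one idea.

From randomized sums to squares. With the `X`'s frozen, the sum is a homogeneous Rademacher chaos of
order `d` whose variance is the sum of squares. The fourth moment of a chaos is at most `9 ^ d`
times the square of its second moment, so by Paley–Zygmund it exceeds half its variance with
probability at least `(4 * 9 ^ d)⁻¹`. Almost sure convergence to zero therefore forces the variances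
to zero (`tendsto_sum_sq_of_ae_tendsto_chaosSum`).

From squares to truncation sets. Sums over translated index sets in disjoint dyadic blocks are
independent, so the second Borel–Cantelli lemma makes the tail probabilities of the sums of squares
summable along `2 ^ k`. If a decoupled sample leaves `A_{k,d}`, then for some set `J` of coordinates
a conditional expectation of the sum of squares given the coordinates outside `J` is too large,
while all marginals over proper subsets of `J` are bounded because of the previous truncations.
These bounds control the conditional covariances, and Paley–Zygmund shows that the sum of squares is
itself large with conditional probability bounded below (`decoupledLaw_exists_notMem_truncSet_le`).

Coupled against decoupled. A decoupled sample embeds in a single longer sequence by giving each of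
the `d` sequences its own block. Conversely, a random coloring of one sequence by `d` colors sees a
given increasing multi-index correctly colored with probability `d ^ (-d)`. Only sums of nonnegative
terms and visits to sets have to be compared.

From truncation sets to randomized sums. By the first Borel–Cantelli lemma the truncated and full
sums eventually agree, and Doob's inequality reduces the rest to summability of `2 ^ (k d) E(h²
1_{A_{k,d}}) / γ_{2^k}²`. The tail condition on `γ` bounds this series by its first-entrance part,
over `A_{k+1,d} \ A_{k,d}`. There the moment is at most a constant times the probability of a visit,
hence of leaving `A_{k,d}`, once that probability is small (`tsum_truncated_moment_lt_top`). -/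

/-! ### Paley–Zygmund inequality -/

section PaleyZygmund

/-- A Paley–Zygmund inequality: `(∫ Z)² ≤ 4 K ν(Z ≥ ∫ Z / 2)` as soon as `∫ Z² ≤ K`. -/
theorem sq_le_four_mul_measure_half_le {α : Type*} [MeasurableSpace α] (ν : Measure α)
    [IsProbabilityMeasure ν] {Z : α → ENNReal} (hZ : Measurable Z) {m K : ENNReal}
    (hm : ∫⁻ a, Z a ∂ν = m) (hK : ∫⁻ a, Z a ^ 2 ∂ν ≤ K) (hK_top : K ≠ ⊤) (hm_top : m ≠ ⊤) :
    m ^ 2 ≤ 4 * K * ν {a | m / 2 ≤ Z a} := by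
  rcases eq_or_ne m 0 with rfl | hm0
  · simp
  have hA : MeasurableSet {a | m / 2 ≤ Z a} := measurableSet_le measurable_const hZ
  -- On the event this follows from `(m Z - 2 K)² ≥ 0`; off it, from `2 Z ≤ m`. Integrated, it reads
  -- `K m² ≤ 4 K² ν(Z ≥ m / 2)`, and a factor `K` cancels because `K = 0` would force `m = 0`.
  have hpt : ∀ a, 4 * K * m * Z a ≤ 2 * K * m ^ 2 + m ^ 2 * Z a ^ 2
      + 4 * K ^ 2 * {a | m / 2 ≤ Z a}.indicator 1 a := by
    intro a
    rcases eq_or_ne (Z a) ⊤ with h | h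
    · have : m ^ 2 * Z a ^ 2 = ⊤ := by simp [h, hm0]
      simp [this]
    by_cases ha : m / 2 ≤ Z a
    · rw [Set.indicator_of_mem (by exact ha)]
      lift K to NNReal using hK_top
      lift m to NNReal using hm_top
      lift Z a to NNReal using h with z
      simp only [Pi.one_apply, mul_one]
      norm_cast
      rw [← NNReal.coe_le_coe]
      push_cast
      have hp : (0:ℝ) ≤ 2 * K * m ^ 2 := by positivity
      nlinarith [sq_nonneg ((m:ℝ) * z - 2 * K)]
    · rw [Set.indicator_of_notMem (by exact ha)]
      have h1 : 2 * Z a ≤ m := by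
        rw [mul_comm]
        exact (ENNReal.le_div_iff_mul_le (by simp) (by simp)).1 (not_le.1 ha).le
      calc 4 * K * m * Z a = 2 * K * m * (2 * Z a) := by ring
        _ ≤ 2 * K * m * m := by gcongr
        _ = 2 * K * m ^ 2 := by ring
        _ ≤ _ := by rw [mul_zero, add_zero]; exact le_self_add
  have hint := lintegral_mono (μ := ν) hpt
  rw [lintegral_const_mul _ hZ, hm, lintegral_add_right _ (by
      exact (measurable_const.mul (measurable_one.indicator hA))),
    lintegral_add_left measurable_const, lintegral_const_mul _ (hZ.pow_const 2),
    lintegral_const_mul _ (measurable_one.indicator hA), lintegral_indicator_one hA,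
    lintegral_const, measure_univ, mul_one] at hint
  replace hint : 4 * K * m * m ≤ 2 * K * m ^ 2 + m ^ 2 * K
      + 4 * K ^ 2 * ν {a | m / 2 ≤ Z a} := hint.trans (by gcongr)
  have hK0 : K ≠ 0 := by
    rintro rfl
    have h0 := (lintegral_eq_zero_iff (hZ.pow_const 2)).1 (nonpos_iff_eq_zero.1 hK)
    refine hm0 (hm ▸ (lintegral_eq_zero_iff hZ).2 ?_)
    filter_upwards [h0] with a ha
    simpa using ha
  have hP : ν {a | m / 2 ≤ Z a} ≠ ⊤ := measure_ne_top _ _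
  generalize ν {a | m / 2 ≤ Z a} = p at hint hP ⊢
  lift K to NNReal using hK_top
  lift m to NNReal using hm_top
  lift p to NNReal using hP
  norm_cast at hint hK0 ⊢
  rw [← NNReal.coe_le_coe] at hint ⊢
  push_cast at hint ⊢
  have hKpos : (0 : ℝ) < K := by exact_mod_cast pos_iff_ne_zero.2 hK0
  refine le_of_mul_le_mul_left ?_ hKpos
  nlinarith

end PaleyZygmund

/-! ### Random signs and hypercontractivity for multilinear polynomials -/

section Signs

open Classical in
/-- Change the sign of the coordinate `p`. -/
noncomputable def flipSign {ι : Type*} (p : ι) (e : ι → ℝ) : ι → ℝ := Function.update e p (-e p)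

@[simp] theorem flipSign_self {ι : Type*} (p : ι) (e : ι → ℝ) : flipSign p e p = -e p := by
  simp [flipSign]

theorem flipSign_of_ne {ι : Type*} {p q : ι} (h : q ≠ p) (e : ι → ℝ) : flipSign p e q = e q := by
  simp [flipSign, h]

theorem measurable_flipSign {ι : Type*} (p : ι) : Measurable (flipSign p) := by
  classical
  rw [measurable_pi_iff]
  intro q
  by_cases h : q = p
  · subst h
    simp only [flipSign_self]
    fun_prop
  · simp only [flipSign_of_ne h]
    fun_prop

/-- A law on `ι → ℝ` carried by `{-1, 1}^ι` and invariant under sign changes of coordinates. -/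
structure IsSignMeasure {ι : Type*} (ρ : Measure (ι → ℝ)) : Prop where
  sign : ∀ p, ∀ᵐ e ∂ρ, e p = 1 ∨ e p = -1
  flip : ∀ p, ρ.map (flipSign p) = ρ

variable {ι : Type*} {ρ : Measure (ι → ℝ)}

theorem IsSignMeasure.integral_eq_zero (hρ : IsSignMeasure ρ) {F : (ι → ℝ) → ℝ}
    (hF : Measurable F) (p : ι) (hodd : ∀ e, F (flipSign p e) = -F e) : ∫ e, F e ∂ρ = 0 := by
  have h : ∫ e, F e ∂ρ = ∫ e, F (flipSign p e) ∂ρ := by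
    conv_lhs => rw [← hρ.flip p]
    exact integral_map (measurable_flipSign p).aemeasurable hF.aestronglyMeasurable
  simp only [hodd, integral_neg] at h
  linarith

theorem IsSignMeasure.ae_abs_prod (hρ : IsSignMeasure ρ) (V : Finset ι) :
    ∀ᵐ e ∂ρ, ∀ p ∈ V, e p = 1 ∨ e p = -1 :=
  (Finset.eventually_all V).2 fun p _ => hρ.sign p

theorem IsSignMeasure.integrable_of_bound [IsProbabilityMeasure ρ] (hρ : IsSignMeasure ρ)
    (V : Finset ι) {F : (ι → ℝ) → ℝ} (hF : Measurable F) (M : ℝ)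
    (hM : ∀ e : ι → ℝ, (∀ p ∈ V, e p = 1 ∨ e p = -1) → |F e| ≤ M) : Integrable F ρ :=
  .of_bound hF.aestronglyMeasurable M ((hρ.ae_abs_prod V).mono hM)

/-- The multilinear polynomial with coefficients `a S`, `S ⊆ V`. -/
noncomputable def multilin (V : Finset ι) (a : Finset ι → ℝ) (e : ι → ℝ) : ℝ :=
  ∑ S ∈ V.powerset, a S * ∏ p ∈ S, e p

theorem measurable_multilin (V : Finset ι) (a : Finset ι → ℝ) : Measurable (multilin V a) := by
  unfold multilin
  fun_prop

theorem abs_multilin_le (V : Finset ι) (a : Finset ι → ℝ) (e : ι → ℝ)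
    (he : ∀ p ∈ V, e p = 1 ∨ e p = -1) : |multilin V a e| ≤ ∑ S ∈ V.powerset, |a S| := by
  refine (Finset.abs_sum_le_sum_abs _ _).trans (Finset.sum_le_sum fun S hS => ?_)
  rw [abs_mul, Finset.abs_prod, Finset.prod_eq_one, mul_one]
  intro p hp
  rcases he p (Finset.mem_powerset.1 hS hp) with h | h <;> simp [h]

theorem multilin_flipSign (V : Finset ι) (a : Finset ι → ℝ) {p : ι} (hp : p ∉ V) (e : ι → ℝ) :
    multilin V a (flipSign p e) = multilin V a e := by
  refine Finset.sum_congr rfl fun S hS => ?_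
  congr 1
  refine Finset.prod_congr rfl fun q hq => flipSign_of_ne ?_ e
  rintro rfl
  exact hp (Finset.mem_powerset.1 hS hq)

theorem multilin_insert [DecidableEq ι] {V : Finset ι} {v : ι} (hv : v ∉ V) (a : Finset ι → ℝ)
    (e : ι → ℝ) : multilin (insert v V) a e
      = multilin V a e + e v * multilin V (fun S => a (insert v S)) e := by
  unfold multilin
  rw [Finset.sum_powerset_insert hv, Finset.mul_sum]
  congr 1
  refine Finset.sum_congr rfl fun S hS => ?_
  rw [Finset.prod_insert fun h => hv (Finset.mem_powerset.1 hS h)]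
  ring

/-- Cauchy–Schwarz, from the nonpositive discriminant of `s ↦ ∫ (s f - g)²`. -/
theorem IsSignMeasure.sq_integral_mul_le [IsProbabilityMeasure ρ] {f g : (ι → ℝ) → ℝ}
    (hff : Integrable (fun e => f e ^ 2) ρ) (hgg : Integrable (fun e => g e ^ 2) ρ)
    (hfg : Integrable (fun e => f e * g e) ρ) :
    (∫ e, f e * g e ∂ρ) ^ 2 ≤ (∫ e, f e ^ 2 ∂ρ) * ∫ e, g e ^ 2 ∂ρ := by
  have h : discrim (∫ e, f e ^ 2 ∂ρ) (-2 * ∫ e, f e * g e ∂ρ) (∫ e, g e ^ 2 ∂ρ) ≤ 0 := by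
    refine discrim_le_zero fun s => ?_
    have : 0 ≤ ∫ e, (s * f e - g e) ^ 2 ∂ρ := integral_nonneg fun e => sq_nonneg _
    have h2 : ∀ e, (s * f e - g e) ^ 2 = s * s * f e ^ 2 + (-2 * s) * (f e * g e) + g e ^ 2 := by
      intro e; ring
    simp_rw [h2] at this
    rw [integral_add ((hff.const_mul _).fun_add (hfg.const_mul _)) hgg,
      integral_add (hff.const_mul _) (hfg.const_mul _), integral_const_mul,
      integral_const_mul] at this
    linarith
  unfold discrim at h
  linarith

/-- Second moment and hypercontractive fourth moment bound for a multilinear polynomial of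
degree at most `d` in random signs. -/
theorem IsSignMeasure.moments_multilin [IsProbabilityMeasure ρ] (hρ : IsSignMeasure ρ)
    (V : Finset ι) : ∀ (d : ℕ) (a : Finset ι → ℝ), (∀ S ⊆ V, d < S.card → a S = 0) →
      ∫ e, multilin V a e ^ 2 ∂ρ = ∑ S ∈ V.powerset, a S ^ 2 ∧
      ∫ e, multilin V a e ^ 4 ∂ρ ≤ 9 ^ d * (∑ S ∈ V.powerset, a S ^ 2) ^ 2 := by
  classical
  induction V using Finset.induction with
  | empty =>
    intro d a _
    simp only [multilin, Finset.powerset_empty, Finset.sum_singleton, Finset.prod_empty, mul_one,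
      integral_const, probReal_univ, one_smul, true_and]
    have : (1 : ℝ) ≤ 9 ^ d := one_le_pow₀ (by norm_num)
    nlinarith [sq_nonneg (a ∅ ^ 2)]
  | insert v V hv ih =>
    intro d a ha
    set a' : Finset ι → ℝ := fun S => a (insert v S) with ha'
    set A := multilin V a' with hA
    set B := multilin V a with hB
    have hsum : ∑ S ∈ (insert v V).powerset, a S ^ 2
        = ∑ S ∈ V.powerset, a S ^ 2 + ∑ S ∈ V.powerset, a' S ^ 2 := by
      rw [Finset.sum_powerset_insert hv]
    -- Induction on the variables: `Q = B + e_v A`, where `A` and `B` do not involve `e_v` and `A`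
    -- has degree one less. Odd powers of `e_v` integrate to zero by the sign flip and even ones
    -- equal 1.
    have hQ : ∀ e, multilin (insert v V) a e = B e + e v * A e := multilin_insert hv a
    have mA : Measurable A := measurable_multilin _ _
    have mB : Measurable B := measurable_multilin _ _
    have mv : Measurable fun e : ι → ℝ => e v := measurable_pi_apply v
    obtain ⟨hB2, hB4⟩ := ih d a fun S hS => ha S (hS.trans (Finset.subset_insert _ _))
    have hfA : ∀ e, A (flipSign v e) = A e := multilin_flipSign V a' hv
    have hfB : ∀ e, B (flipSign v e) = B e := multilin_flipSign V a hv
    have hint : ∀ j k l : ℕ, Integrable (fun e => e v ^ j * A e ^ k * B e ^ l) ρ := by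
      intro j k l
      refine hρ.integrable_of_bound (insert v V) (by fun_prop)
        ((∑ S ∈ V.powerset, |a' S|) ^ k * (∑ S ∈ V.powerset, |a S|) ^ l) fun e he => ?_
      have h1 : |e v| = 1 := by
        rcases he v (Finset.mem_insert_self _ _) with h | h <;> simp [h]
      rw [abs_mul, abs_mul, abs_pow, abs_pow, abs_pow, h1, one_pow, one_mul]
      have hV : ∀ p ∈ V, e p = 1 ∨ e p = -1 := fun p hp => he p (Finset.mem_insert_of_mem hp)
      gcongr
      · exact abs_multilin_le V a' e hV
      · exact abs_multilin_le V a e hV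
    have hodd : ∀ j k l : ℕ, Odd j → ∫ e, e v ^ j * A e ^ k * B e ^ l ∂ρ = 0 := by
      intro j k l hj
      refine hρ.integral_eq_zero (by fun_prop) v fun e => ?_
      rw [hfA, hfB, flipSign_self, hj.neg_pow]
      ring
    have heven : ∀ j k l : ℕ, Even j →
        ∫ e, e v ^ j * A e ^ k * B e ^ l ∂ρ = ∫ e, A e ^ k * B e ^ l ∂ρ := by
      intro j k l hj
      refine integral_congr_ae ?_
      filter_upwards [hρ.sign v] with e he
      have : e v ^ j = 1 := by
        rcases he with h | h
        · simp [h]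
        · rw [h, hj.neg_one_pow]
      rw [this, one_mul]
    have hQ2 : ∫ e, multilin (insert v V) a e ^ 2 ∂ρ = ∫ e, B e ^ 2 ∂ρ + ∫ e, A e ^ 2 ∂ρ := by
      have : ∀ e, multilin (insert v V) a e ^ 2 = e v ^ 0 * A e ^ 0 * B e ^ 2
          + 2 * (e v ^ 1 * A e ^ 1 * B e ^ 1) + e v ^ 2 * A e ^ 2 * B e ^ 0 := by
        intro e; rw [hQ]; ring
      simp_rw [this]
      rw [integral_add ((hint _ _ _).fun_add ((hint _ _ _).const_mul _)) (hint _ _ _),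
        integral_add (hint _ _ _) ((hint _ _ _).const_mul _), integral_const_mul,
        hodd 1 1 1 (by decide), heven 2 2 0 (by decide)]
      simp
    have hQ4 : ∫ e, multilin (insert v V) a e ^ 4 ∂ρ
        = ∫ e, B e ^ 4 ∂ρ + 6 * ∫ e, A e ^ 2 * B e ^ 2 ∂ρ + ∫ e, A e ^ 4 ∂ρ := by
      have : ∀ e, multilin (insert v V) a e ^ 4 = e v ^ 0 * A e ^ 0 * B e ^ 4
          + 4 * (e v ^ 1 * A e ^ 1 * B e ^ 3) + 6 * (e v ^ 2 * A e ^ 2 * B e ^ 2)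
          + 4 * (e v ^ 3 * A e ^ 3 * B e ^ 1) + e v ^ 4 * A e ^ 4 * B e ^ 0 := by
        intro e; rw [hQ]; ring
      simp_rw [this]
      rw [integral_add ((((hint _ _ _).fun_add ((hint _ _ _).const_mul _)).fun_add
          ((hint _ _ _).const_mul _)).fun_add ((hint _ _ _).const_mul _)) (hint _ _ _),
        integral_add (((hint _ _ _).fun_add ((hint _ _ _).const_mul _)).fun_add
          ((hint _ _ _).const_mul _)) ((hint _ _ _).const_mul _),
        integral_add ((hint _ _ _).fun_add ((hint _ _ _).const_mul _)) ((hint _ _ _).const_mul _),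
        integral_add (hint _ _ _) ((hint _ _ _).const_mul _), integral_const_mul,
        integral_const_mul, integral_const_mul,
        hodd 1 1 3 (by decide), hodd 3 3 1 (by decide), heven 4 4 0 (by decide),
        heven 2 2 2 (by decide)]
      simp
    have hcs : (∫ e, A e ^ 2 * B e ^ 2 ∂ρ) ^ 2 ≤ (∫ e, A e ^ 4 ∂ρ) * ∫ e, B e ^ 4 ∂ρ := by
      have h := IsSignMeasure.sq_integral_mul_le (ρ := ρ) (f := fun e => A e ^ 2)
        (g := fun e => B e ^ 2) (by simpa [← pow_mul] using hint 0 4 0)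
        (by simpa [← pow_mul] using hint 0 0 4) (by simpa using hint 0 2 2)
      simpa only [← pow_mul] using h
    rw [hsum, hQ2, hQ4, hB2]
    set x := ∑ S ∈ V.powerset, a' S ^ 2 with hx
    set y := ∑ S ∈ V.powerset, a S ^ 2 with hy
    have hx0 : 0 ≤ x := Finset.sum_nonneg fun _ _ => sq_nonneg _
    have hy0 : 0 ≤ y := Finset.sum_nonneg fun _ _ => sq_nonneg _
    cases d with
    | zero =>
      -- In degree zero every coefficient of `A` belongs to a nonempty set, so `A` vanishes.
      have hz : ∀ S ∈ V.powerset, a' S = 0 := fun S hS => ha _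
        (Finset.insert_subset_insert _ (Finset.mem_powerset.1 hS)) (by simp)
      have hA0 : A = 0 := by
        funext e
        exact Finset.sum_eq_zero fun S hS => by simp [hz S hS]
      have hx' : x = 0 := Finset.sum_eq_zero fun S hS => by simp [hz S hS]
      simp [hA0, hx']
      simpa using hB4
    | succ k =>
      obtain ⟨hA2, hA4⟩ := ih k a' fun S hS hc => ha _ (Finset.insert_subset_insert _ hS) (by
        rw [Finset.card_insert_of_notMem fun h => hv (hS h)]; omega)
      refine ⟨by rw [hA2], ?_⟩
      set c := ∫ e, A e ^ 2 * B e ^ 2 ∂ρ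
      have hq : (0 : ℝ) < 3 ^ k := by positivity
      have h9 : (9 : ℝ) ^ k = (3 ^ k) ^ 2 := by rw [← pow_mul, mul_comm, pow_mul]; norm_num
      rw [pow_succ, h9] at hB4
      rw [h9] at hA4
      rw [pow_succ, h9]
      set q : ℝ := 3 ^ k
      -- Here `q = 3 ^ k`. The cross term `6 c` becomes at most `18 q² x y = 2 * 9 ^ (k + 1) x y`,
      -- exactly the one in `9 ^ (k + 1) (x + y)²`; this is what fixes the constant 9.
      have hc : c ≤ (q * x) * (3 * q * y) := by
        refine (abs_le_of_sq_le_sq' ?_ (by positivity)).2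
        calc c ^ 2 ≤ _ := hcs
          _ ≤ (q ^ 2 * x ^ 2) * (q ^ 2 * 9 * y ^ 2) := by
            refine mul_le_mul hA4 hB4 (integral_nonneg fun e => by positivity) (by positivity)
          _ = _ := by ring
      nlinarith [mul_nonneg hx0 hy0, mul_nonneg (sq_nonneg q) (sq_nonneg x)]

end Signs

/-! ### Homogeneous Rademacher chaoses: moments, lower tails, maximal inequality -/

section Chaos

variable {ι τ : Type*} {d : ℕ} {ρ : Measure (ι → ℝ)}

/-- The homogeneous polynomial `∑_{i ∈ T} c_i ∏_r e_{idx i r}`. -/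
noncomputable def chaosSum (idx : τ → Fin d → ι) (T : Finset τ) (c : τ → ℝ) (e : ι → ℝ) : ℝ :=
  ∑ i ∈ T, (∏ r, e (idx i r)) * c i

theorem measurable_chaosSum (idx : τ → Fin d → ι) (T : Finset τ) (c : τ → ℝ) :
    Measurable (chaosSum idx T c) := by
  unfold chaosSum
  fun_prop

/-- The multi-indices `idx i`, `i ∈ T`, have distinct entries and distinct sets of entries. -/
structure IsTetrahedral (idx : τ → Fin d → ι) (T : Finset τ) : Prop where
  injective : ∀ i ∈ T, Function.Injective (idx i)
  range_inj : ∀ i ∈ T, ∀ j ∈ T, Set.range (idx i) = Set.range (idx j) → i = j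

/-- Monomials are collected by their set of variables. Injectivity of each multi-index makes the
monomial square-free, and distinct ranges make each coefficient a single `c i`, so that the sum of
squares is preserved. -/
theorem IsTetrahedral.exists_multilin {idx : τ → Fin d → ι} {T : Finset τ}
    (hT : IsTetrahedral idx T) (c : τ → ℝ) : ∃ (V : Finset ι) (a : Finset ι → ℝ),
      (∀ e, chaosSum idx T c e = multilin V a e) ∧
      (∀ S ⊆ V, d < S.card → a S = 0) ∧ ∑ S ∈ V.powerset, a S ^ 2 = ∑ i ∈ T, c i ^ 2 := by
  classical
  set supp : τ → Finset ι := fun i => Finset.univ.image (idx i) with hsupp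
  have hmaps : ∀ i ∈ T, supp i ∈ (T.biUnion supp).powerset := fun i hi =>
    Finset.mem_powerset.2 (Finset.subset_biUnion_of_mem supp hi)
  have hinj : ∀ i ∈ T, ∀ j ∈ T, supp i = supp j → i = j := fun i hi j hj h =>
    hT.range_inj i hi j hj (by
      have := congrArg (fun s : Finset ι => (s : Set ι)) h
      simpa [hsupp] using this)
  refine ⟨T.biUnion supp, fun S => ∑ i ∈ T with supp i = S, c i, fun e => ?_, fun S _ hS => ?_, ?_⟩
  · unfold multilin chaosSum
    rw [← Finset.sum_fiberwise_of_maps_to hmaps]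
    refine Finset.sum_congr rfl fun S _ => ?_
    rw [Finset.sum_mul]
    refine Finset.sum_congr rfl fun i hi => ?_
    obtain ⟨hiT, rfl⟩ := Finset.mem_filter.1 hi
    rw [mul_comm, Finset.prod_image fun a _ b _ h => hT.injective i hiT h]
  · refine Finset.sum_eq_zero fun i hi => ?_
    obtain ⟨hiT, rfl⟩ := Finset.mem_filter.1 hi
    have := Finset.card_image_le (s := Finset.univ) (f := idx i)
    simp only [Finset.card_univ, Fintype.card_fin] at this
    exact absurd this (not_le.2 hS)
  · rw [← Finset.sum_fiberwise_of_maps_to hmaps]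
    refine Finset.sum_congr rfl fun S _ => ?_
    have hcard : (T.filter fun i => supp i = S).card ≤ 1 := by
      refine Finset.card_le_one.2 fun i hi j hj => ?_
      rw [Finset.mem_filter] at hi hj
      exact hinj i hi.1 j hj.1 (hi.2.trans hj.2.symm)
    rcases Nat.le_one_iff_eq_zero_or_eq_one.1 hcard with h | h
    · simp [Finset.card_eq_zero.1 h]
    · obtain ⟨i, hi⟩ := Finset.card_eq_one.1 h
      simp [hi]

theorem IsTetrahedral.integral_sq [IsProbabilityMeasure ρ] (hρ : IsSignMeasure ρ)
    {idx : τ → Fin d → ι} {T : Finset τ} (hT : IsTetrahedral idx T) (c : τ → ℝ) :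
    ∫ e, chaosSum idx T c e ^ 2 ∂ρ = ∑ i ∈ T, c i ^ 2 := by
  obtain ⟨V, a, h1, h2, h3⟩ := hT.exists_multilin c
  simp_rw [h1, ← h3]
  exact (hρ.moments_multilin V d a h2).1

theorem IsTetrahedral.integrable_pow [IsProbabilityMeasure ρ] (hρ : IsSignMeasure ρ)
    {idx : τ → Fin d → ι} {T : Finset τ} (hT : IsTetrahedral idx T) (c : τ → ℝ) (n : ℕ) :
    Integrable (fun e => chaosSum idx T c e ^ n) ρ := by
  obtain ⟨V, a, h1, h2, h3⟩ := hT.exists_multilin c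
  refine hρ.integrable_of_bound V ((measurable_chaosSum _ _ _).pow_const n)
    ((∑ S ∈ V.powerset, |a S|) ^ n) fun e he => ?_
  rw [h1, abs_pow]
  exact pow_le_pow_left₀ (abs_nonneg _) (abs_multilin_le V a e he) n

theorem IsTetrahedral.integral_pow_four_le [IsProbabilityMeasure ρ] (hρ : IsSignMeasure ρ)
    {idx : τ → Fin d → ι} {T : Finset τ} (hT : IsTetrahedral idx T) (c : τ → ℝ) :
    ∫ e, chaosSum idx T c e ^ 4 ∂ρ ≤ 9 ^ d * (∑ i ∈ T, c i ^ 2) ^ 2 := by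
  obtain ⟨V, a, h1, h2, h3⟩ := hT.exists_multilin c
  simp_rw [h1, ← h3]
  exact (hρ.moments_multilin V d a h2).2

/-- A homogeneous chaos exceeds half of its second moment with probability bounded below. -/
theorem IsTetrahedral.le_measure_half [IsProbabilityMeasure ρ] (hρ : IsSignMeasure ρ)
    {idx : τ → Fin d → ι} {T : Finset τ} (hT : IsTetrahedral idx T) (c : τ → ℝ)
    (hc : 0 < ∑ i ∈ T, c i ^ 2) :
    (4 * 9 ^ d)⁻¹ ≤ ρ {e | (∑ i ∈ T, c i ^ 2) / 2 ≤ chaosSum idx T c e ^ 2} := by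
  set s := ∑ i ∈ T, c i ^ 2 with hs
  have hmeas : Measurable fun e => ENNReal.ofReal (chaosSum idx T c e ^ 2) :=
    ((measurable_chaosSum _ _ _).pow_const 2).ennreal_ofReal
  have hm : ∫⁻ e, ENNReal.ofReal (chaosSum idx T c e ^ 2) ∂ρ = ENNReal.ofReal s := by
    rw [← ofReal_integral_eq_lintegral_ofReal (hT.integrable_pow hρ c 2)
      (ae_of_all _ fun e => sq_nonneg _), hT.integral_sq hρ]
  have hK : ∫⁻ e, ENNReal.ofReal (chaosSum idx T c e ^ 2) ^ 2 ∂ρ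
      ≤ ENNReal.ofReal (9 ^ d * s ^ 2) := by
    simp_rw [← ENNReal.ofReal_pow (sq_nonneg _), ← pow_mul]
    rw [← ofReal_integral_eq_lintegral_ofReal (hT.integrable_pow hρ c _)
      (ae_of_all _ fun e => Even.pow_nonneg (by decide) _)]
    exact ENNReal.ofReal_le_ofReal (hT.integral_pow_four_le hρ c)
  have h := sq_le_four_mul_measure_half_le ρ hmeas hm hK ENNReal.ofReal_ne_top
    ENNReal.ofReal_ne_top
  have hset : {e | ENNReal.ofReal s / 2 ≤ ENNReal.ofReal (chaosSum idx T c e ^ 2)}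
      = {e | s / 2 ≤ chaosSum idx T c e ^ 2} := by
    ext e
    rw [Set.mem_ofPred_eq, Set.mem_ofPred_eq, ← ENNReal.ofReal_le_ofReal_iff (sq_nonneg _),
      ENNReal.ofReal_div_of_pos two_pos, ENNReal.ofReal_ofNat]
  rw [hset, ENNReal.ofReal_mul (by positivity), ENNReal.ofReal_pow hc.le,
    ENNReal.ofReal_pow (by norm_num), ENNReal.ofReal_ofNat] at h
  have hs0 : ENNReal.ofReal s ^ 2 ≠ 0 := pow_ne_zero _ (by simpa using hc)
  have hst : ENNReal.ofReal s ^ 2 ≠ ⊤ := by simp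
  rw [← one_div]
  refine ENNReal.div_le_of_le_mul ?_
  refine (ENNReal.mul_le_mul_iff_right hs0 hst).1 ?_
  rw [mul_one]
  refine h.trans (le_of_eq ?_)
  ring

/-- If a sequence of homogeneous chaoses of order `d` tends to zero almost surely, then so do
the sums of squares of the coefficients. -/
theorem tendsto_sum_sq_of_ae_tendsto_chaosSum [IsProbabilityMeasure ρ] (hρ : IsSignMeasure ρ)
    {idx : τ → Fin d → ι} {T : ℕ → Finset τ} (hT : ∀ n, IsTetrahedral idx (T n))
    (c : ℕ → τ → ℝ)
    (hlim : ∀ᵐ e ∂ρ, Tendsto (fun n => chaosSum idx (T n) (c n) e) atTop (𝓝 0)) :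
    Tendsto (fun n => ∑ i ∈ T n, c n i ^ 2) atTop (𝓝 0) := by
  have hmeas := tendstoInMeasure_of_tendsto_ae (μ := ρ)
    (f := fun n => chaosSum idx (T n) (c n)) (g := fun _ => 0)
    (fun n => (measurable_chaosSum _ _ _).aestronglyMeasurable) hlim
  rw [Metric.tendsto_atTop]
  intro η hη
  have hpos : (0 : ENNReal) < (4 * 9 ^ d)⁻¹ :=
    ENNReal.inv_pos.2 (ENNReal.mul_ne_top (by simp) (by simp))
  -- If the variance is at least `η`, then `|Q| ≥ √(η / 2)` with probability at least `(4 * 9 ^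
  -- d)⁻¹`. This bound does not depend on `n`, so it contradicts convergence in measure.
  have h1 := hmeas (ENNReal.ofReal (√(η / 2))) (by simpa using hη)
  obtain ⟨N, hN⟩ := eventually_atTop.1 (h1.eventually_lt_const hpos)
  refine ⟨N, fun n hn => ?_⟩
  have h0 : 0 ≤ ∑ i ∈ T n, c n i ^ 2 := Finset.sum_nonneg fun _ _ => sq_nonneg _
  rw [Real.dist_eq, sub_zero, abs_of_nonneg h0]
  by_contra! hcon
  refine absurd ((hT n).le_measure_half hρ (c n) (hη.trans_le hcon))
    (not_le.2 (lt_of_le_of_lt (measure_mono fun e he => ?_) (hN n hn)))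
  simp only [Set.mem_ofPred_eq, edist_zero_right] at he ⊢
  rw [← ofReal_norm, Real.norm_eq_abs]
  refine ENNReal.ofReal_le_ofReal (Real.sqrt_le_iff.2 ⟨abs_nonneg _, ?_⟩)
  rw [sq_abs]
  linarith

/-- An increasing family of tetrahedral index sets, each new multi-index having an entry of a new
level. -/
structure IsAdaptedIndexing (idx : τ → Fin d → ι) (T : ℕ → Finset τ) (lev : ι → ℕ) : Prop where
  tetrahedral : ∀ n, IsTetrahedral idx (T n)
  mono : Monotone T
  lev_le : ∀ n, ∀ i ∈ T n, ∀ r, lev (idx i r) ≤ n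
  lt_lev : ∀ n, ∀ i ∈ T (n + 1), i ∉ T n → ∃ r, n < lev (idx i r)

/-- The filtration on `ι → ℝ` generated by the coordinates of level at most `n`. -/
def levelFiltration (lev : ι → ℕ) :
    Filtration ℕ (inferInstance : MeasurableSpace (ι → ℝ)) where
  seq n := MeasurableSpace.comap (fun (e : ι → ℝ) (p : {p // lev p ≤ n}) => e p) inferInstance
  mono' m n hmn := by
    rw [← measurable_iff_comap_le]
    have h : (fun (e : ι → ℝ) (p : {p // lev p ≤ m}) => e p)
        = (fun (x : {p // lev p ≤ n} → ℝ) (p : {p // lev p ≤ m}) => x ⟨p, p.2.trans hmn⟩)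
          ∘ fun (e : ι → ℝ) (p : {p // lev p ≤ n}) => e p := rfl
    rw [h]
    exact Measurable.comp (by fun_prop) (comap_measurable _)
  le' n := by
    rw [← measurable_iff_comap_le]
    fun_prop

/-- Doob's maximal inequality for homogeneous chaoses. -/
theorem IsAdaptedIndexing.maximal_le [IsProbabilityMeasure ρ] (hρ : IsSignMeasure ρ)
    {idx : τ → Fin d → ι} {T : ℕ → Finset τ} {lev : ι → ℕ} (hT : IsAdaptedIndexing idx T lev)
    (c : τ → ℝ) (N : ℕ) {t : ℝ} (ht : 0 ≤ t) :
    ENNReal.ofReal (t ^ 2) * ρ {e | ∃ n ≤ N, t ≤ |chaosSum idx (T n) c e|}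
      ≤ ENNReal.ofReal (∑ i ∈ T N, c i ^ 2) := by
  classical
  have hmeasQ : ∀ n, Measurable[levelFiltration lev n] (chaosSum idx (T n) c) := by
    intro n
    have h : chaosSum idx (T n) c = (fun x : {p // lev p ≤ n} → ℝ =>
        ∑ i ∈ (T n).attach, (∏ r, x ⟨idx i r, hT.lev_le n i i.2 r⟩) * c i)
        ∘ fun (e : ι → ℝ) (p : {p // lev p ≤ n}) => e p := by
      funext e
      simp only [chaosSum, Function.comp]
      rw [← Finset.sum_attach]
    rw [h]
    exact Measurable.comp (by fun_prop) (comap_measurable _)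
  have hsub : Submartingale (fun n e => chaosSum idx (T n) c e ^ 2) (levelFiltration lev) ρ := by
    refine submartingale_of_setIntegral_le_succ
      (fun n => ((hmeasQ n).pow_const 2).stronglyMeasurable)
      (fun n => (hT.tetrahedral n).integrable_pow hρ c 2) fun n s hs => ?_
    have hs' : MeasurableSet s := (levelFiltration lev).le n s hs
    have hflip_s : ∀ p, n < lev p → ∀ e, (flipSign p e ∈ s ↔ e ∈ s) := by
      intro p hp e
      obtain ⟨u, _, rfl⟩ := hs
      simp only [Set.mem_preimage]
      have : (fun q : {q // lev q ≤ n} => flipSign p e q) = fun q : {q // lev q ≤ n} => e q := by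
        funext q
        exact flipSign_of_ne (by rintro rfl; exact absurd q.2 (not_le.2 hp)) e
      rw [this]
    have hflip_Q : ∀ p, n < lev p → ∀ e,
        chaosSum idx (T n) c (flipSign p e) = chaosSum idx (T n) c e := by
      intro p hp e
      refine Finset.sum_congr rfl fun i hi => ?_
      congr 1
      refine Finset.prod_congr rfl fun r _ => flipSign_of_ne ?_ e
      rintro rfl
      exact absurd (hT.lev_le n i hi r) (not_le.2 hp)
    set D : (ι → ℝ) → ℝ := chaosSum idx (T (n + 1) \ T n) c with hD
    have hsplit : ∀ e, chaosSum idx (T (n + 1)) c e = chaosSum idx (T n) c e + D e := by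
      intro e
      simp only [hD, chaosSum]
      rw [add_comm (∑ i ∈ T n, _), Finset.sum_sdiff (hT.mono n.le_succ)]
    have hTD : IsTetrahedral idx (T (n + 1) \ T n) :=
      ⟨fun i hi => (hT.tetrahedral (n + 1)).injective i (Finset.sdiff_subset hi),
        fun i hi j hj => (hT.tetrahedral (n + 1)).range_inj i (Finset.sdiff_subset hi) j
          (Finset.sdiff_subset hj)⟩
    have mQ := measurable_chaosSum idx (T n) c
    have mD : Measurable D := measurable_chaosSum idx _ c
    have hI1 := (hT.tetrahedral n).integrable_pow hρ c 2
    have hI3 := (hT.tetrahedral (n + 1)).integrable_pow hρ c 2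
    have hI4 : Integrable (fun e => D e ^ 2) ρ := hTD.integrable_pow hρ c 2
    -- Polarization writes the product in terms of squares already known to be integrable.
    have hI2 : Integrable (fun e => chaosSum idx (T n) c e * D e) ρ := by
      have : (fun e => chaosSum idx (T n) c e * D e) = fun e =>
          1 / 2 * (chaosSum idx (T (n + 1)) c e ^ 2 - chaosSum idx (T n) c e ^ 2 - D e ^ 2) := by
        funext e
        rw [hsplit]
        ring
      rw [this]
      exact ((hI3.sub hI1).sub hI4).const_mul _
    -- Each new monomial contains exactly one copy of a sign of level above `n`. Flipping that sign
    -- preserves `s` and the old sum but negates the monomial. The sign depends on the monomial,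
    -- hence the argument term by term.
    have horth : ∫ e in s, chaosSum idx (T n) c e * D e ∂ρ = 0 := by
      have hterm : ∀ i ∈ T (n + 1) \ T n, ∫ e, s.indicator (fun e => chaosSum idx (T n) c e
          * ((∏ r, e (idx i r)) * c i)) e ∂ρ = 0 := by
        intro i hi
        obtain ⟨hi1, hi0⟩ := Finset.mem_sdiff.1 hi
        obtain ⟨r₀, hr₀⟩ := hT.lt_lev n i hi1 hi0
        refine hρ.integral_eq_zero (Measurable.indicator (by fun_prop) hs') (idx i r₀) fun e => ?_
        have hprod : ∏ r, flipSign (idx i r₀) e (idx i r) = -∏ r, e (idx i r) := by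
          rw [← Finset.mul_prod_erase _ _ (Finset.mem_univ r₀),
            ← Finset.mul_prod_erase _ (fun r => e (idx i r)) (Finset.mem_univ r₀), flipSign_self,
            neg_mul]
          congr 2
          refine Finset.prod_congr rfl fun r hr => flipSign_of_ne ?_ e
          exact fun h => (Finset.mem_erase.1 hr).1
            ((hT.tetrahedral (n + 1)).injective i hi1 h)
        by_cases he : e ∈ s
        · rw [Set.indicator_of_mem ((hflip_s _ hr₀ e).2 he), Set.indicator_of_mem he, hprod,
            hflip_Q _ hr₀]
          ring
        · rw [Set.indicator_of_notMem (fun h => he ((hflip_s _ hr₀ e).1 h)),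
            Set.indicator_of_notMem he, neg_zero]
      rw [← integral_indicator hs']
      have hsum : ∀ e, s.indicator (fun e => chaosSum idx (T n) c e * D e) e
          = ∑ i ∈ T (n + 1) \ T n, s.indicator (fun e => chaosSum idx (T n) c e
          * ((∏ r, e (idx i r)) * c i)) e := by
        intro e
        by_cases he : e ∈ s
        · simp only [Set.indicator_of_mem he, hD]
          rw [chaosSum, chaosSum, Finset.mul_sum]
        · simp [Set.indicator_of_notMem he]
      simp_rw [hsum]
      rw [integral_finsetSum _ fun i hi => ?_, Finset.sum_eq_zero hterm]
      refine Integrable.indicator ?_ hs'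
      have hTi : IsTetrahedral idx {i} :=
        ⟨fun j hj => hTD.injective j (by rw [Finset.mem_singleton.1 hj]; exact hi),
          fun j hj k hk _ => (Finset.mem_singleton.1 hj).trans (Finset.mem_singleton.1 hk).symm⟩
      have h4 := (hTi.integrable_pow hρ c 2)
      have hb := (hI1.add h4)
      refine hb.mono' (by fun_prop) (ae_of_all _ fun e => ?_)
      have : chaosSum idx {i} c e = (∏ r, e (idx i r)) * c i := by simp [chaosSum]
      simp only [Pi.add_apply, this, Real.norm_eq_abs]
      rw [abs_le]
      constructor <;>
        nlinarith [sq_nonneg (chaosSum idx (T n) c e + (∏ r, e (idx i r)) * c i),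
          sq_nonneg (chaosSum idx (T n) c e - (∏ r, e (idx i r)) * c i)]
    have hsq : ∀ e, chaosSum idx (T (n + 1)) c e ^ 2
        = chaosSum idx (T n) c e ^ 2 + 2 * (chaosSum idx (T n) c e * D e) + D e ^ 2 := by
      intro e
      rw [hsplit]
      ring
    simp_rw [hsq]
    rw [integral_add (hI1.integrableOn.fun_add (hI2.integrableOn.const_mul 2)) hI4.integrableOn,
      integral_add hI1.integrableOn (hI2.integrableOn.const_mul 2), integral_const_mul, horth]
    have : 0 ≤ ∫ e in s, D e ^ 2 ∂ρ := integral_nonneg fun e => sq_nonneg _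
    linarith
  have hmax := maximal_ineq hsub (fun n e => sq_nonneg _) (ε := (t ^ 2).toNNReal) N
  have hcoe : ((t ^ 2).toNNReal : ENNReal) = ENNReal.ofReal (t ^ 2) := rfl
  have hcoe' : ((t ^ 2).toNNReal : ℝ) = t ^ 2 := Real.coe_toNNReal _ (sq_nonneg t)
  rw [hcoe, hcoe'] at hmax
  calc ENNReal.ofReal (t ^ 2) * ρ {e | ∃ n ≤ N, t ≤ |chaosSum idx (T n) c e|}
      ≤ _ := by
        refine mul_le_mul_right (measure_mono ?_) _
        rintro e ⟨n, hn, he⟩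
        rw [Set.mem_ofPred_eq, Finset.le_sup'_iff]
        refine ⟨n, Finset.mem_range.2 (by omega), ?_⟩
        rw [← sq_abs (chaosSum idx (T n) c e)]
        gcongr
    _ ≤ _ := hmax
    _ ≤ _ := by
        refine ENNReal.ofReal_le_ofReal ?_
        rw [← (hT.tetrahedral N).integral_sq hρ c]
        exact setIntegral_le_integral ((hT.tetrahedral N).integrable_pow hρ c 2)
          (ae_of_all _ fun e => sq_nonneg _)

end Chaos

/-! ### Conditional second moments of decoupled sums of nonnegative kernels -/

section SecondMoment

/-- The point `(y^{(1)}_{j_1}, …, y^{(d)}_{j_d})`. -/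
def evalTuple {E : Type*} {d : ℕ} (j : Fin d → ℕ) (y : Fin d → ℕ → E) : Fin d → E := fun r => y r (j r)

theorem evalTuple_update {E : Type*} {d : ℕ} (j : Fin d → ℕ) (y : Fin d → ℕ → E) (r : Fin d) (w : ℕ → E) :
    evalTuple j (Function.update y r w) = Function.update (evalTuple j y) r (w (j r)) := by
  funext s
  by_cases h : s = r
  · subst h
    simp [evalTuple]
  · simp [evalTuple, h]

variable {E : Type*} [MeasurableSpace E] {d : ℕ} (μ : Measure E) [IsProbabilityMeasure μ]

/-- The law of an i.i.d. sequence with common law `μ`. -/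
noncomputable def seqLaw : Measure (ℕ → E) := Measure.infinitePi fun _ => μ

instance : IsProbabilityMeasure (seqLaw μ) := by
  unfold seqLaw
  infer_instance

@[fun_prop]
theorem measurable_evalTuple (j : Fin d → ℕ) :
    Measurable (evalTuple j : (Fin d → ℕ → E) → Fin d → E) := by
  unfold evalTuple
  fun_prop

/-- The sequence `y r` enters only through its entry `j r`, which has law `μ`; so integrating out
whole sequences amounts to integrating out single coordinates. -/
theorem lmarginal_comp_evalTuple (j : Fin d → ℕ) {g : (Fin d → E) → ENNReal} (hg : Measurable g)
    (s : Finset (Fin d)) (y : Fin d → ℕ → E) :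
    lmarginal (fun _ => seqLaw μ) s (fun y => g (evalTuple j y)) y
      = lmarginal (fun _ => μ) s g (evalTuple j y) := by
  induction s using Finset.induction generalizing y with
  | empty => simp
  | insert r s hr ih =>
    rw [lmarginal_insert _ (by fun_prop) hr, lmarginal_insert _ hg hr]
    simp_rw [ih, evalTuple_update]
    have h := measurePreserving_eval_infinitePi (fun _ : ℕ => μ) (j r)
    exact h.lintegral_comp
      (f := fun u => lmarginal (fun _ => μ) s g (Function.update (evalTuple j y) r u))
      ((hg.lmarginal _).comp (measurable_update _))

/-- For `r ∈ s` the entries `j r` and `j' r` of the same sequence are distinct, hence independent,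
and the marginal of the product factorizes. -/
theorem lmarginal_comp_evalTuple_mul {j j' : Fin d → ℕ} {f g : (Fin d → E) → ENNReal}
    (hf : Measurable f) (hg : Measurable g) (s : Finset (Fin d)) (hs : ∀ r ∈ s, j r ≠ j' r)
    (y : Fin d → ℕ → E) :
    lmarginal (fun _ => seqLaw μ) s (fun y => f (evalTuple j y) * g (evalTuple j' y)) y
      = lmarginal (fun _ => μ) s f (evalTuple j y)
        * lmarginal (fun _ => μ) s g (evalTuple j' y) := by
  induction s using Finset.induction generalizing y with
  | empty => simp
  | insert r s hr ih =>
    rw [lmarginal_insert _ (by fun_prop) hr, lmarginal_insert _ hf hr, lmarginal_insert _ hg hr]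
    simp_rw [ih fun r hr => hs r (Finset.mem_insert_of_mem hr), evalTuple_update]
    have hne := hs r (Finset.mem_insert_self _ _)
    have hF : Measurable fun u =>
        lmarginal (fun _ => μ) s f (Function.update (evalTuple j y) r u) :=
      (hf.lmarginal _).comp (measurable_update _)
    have hG : Measurable fun u =>
        lmarginal (fun _ => μ) s g (Function.update (evalTuple j' y) r u) :=
      (hg.lmarginal _).comp (measurable_update _)
    have hFG : Measurable fun z : E × E =>
        lmarginal (fun _ => μ) s f (Function.update (evalTuple j y) r z.1)
          * lmarginal (fun _ => μ) s g (Function.update (evalTuple j' y) r z.2) :=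
      (hF.comp measurable_fst).fun_mul (hG.comp measurable_snd)
    rw [← lintegral_prod_mul hF.aemeasurable hG.aemeasurable,
      ← Measure.infinitePi_map_eval_prod (P := fun _ : ℕ => μ) hne, lintegral_map
        hFG (by fun_prop)]
    rfl

/-- The product form of `N ^ (-|K|)`, with `K` the set where `j` and `j'` differ, makes its sum over
`j'` factor over the coordinates. -/
theorem prod_ite_inv_eq (N : ℕ) {j j' : Fin d → ℕ} :
    ∏ r, (if j r = j' r then (1 : ENNReal) else (N : ENNReal)⁻¹)
      = ((N : ENNReal) ^ (Finset.univ.filter fun r => j r ≠ j' r).card)⁻¹ := by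
  rw [Finset.prod_ite, Finset.prod_const_one, one_mul, Finset.prod_const, ENNReal.inv_pow]

/-- Covariances of the summands of a decoupled U-statistic, conditionally on the coordinates
outside `J`. -/
theorem lmarginal_evalTuple_mul_le {N : ℕ} (hN : N ≠ 0) {J : Finset (Fin d)}
    {g : (Fin d → E) → ENNReal} (hg : Measurable g)
    (hgJ : ∀ K ⊂ J, ∀ x, (N : ENNReal) ^ K.card * lmarginal (fun _ => μ) K g x ≤ 1)
    {i j j' : Fin d → ℕ} (hj : ∀ r ∉ J, j r = i r) (hj' : ∀ r ∉ J, j' r = i r)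
    (y : Fin d → ℕ → E) :
    lmarginal (fun _ => seqLaw μ) J (fun y => g (evalTuple j y) * g (evalTuple j' y)) y
      ≤ lmarginal (fun _ => μ) J g (evalTuple i y) ^ 2
        + (∏ r, (if j r = j' r then (1 : ENNReal) else (N : ENNReal)⁻¹))
          * lmarginal (fun _ => μ) J g (evalTuple i y) := by
  set K := Finset.univ.filter fun r => j r ≠ j' r with hK
  have hKJ : K ⊆ J := by
    intro r hr
    by_contra h
    exact (Finset.mem_filter.1 hr).2 ((hj r h).trans (hj' r h).symm)
  have hcongr : ∀ {L : Finset (Fin d)} {l l' : Fin d → ℕ} (_ : ∀ r ∉ L, l r = l' r)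
      (y : Fin d → ℕ → E), lmarginal (fun _ => μ) L g (evalTuple l y)
        = lmarginal (fun _ => μ) L g (evalTuple l' y) := by
    intro L l l' h y
    refine lmarginal_congr _ _ fun r hr => ?_
    simp [evalTuple, h r hr]
  have hjj' : ∀ r ∉ K, j' r = j r := by
    intro r hr
    by_contra h
    exact hr (Finset.mem_filter.2 ⟨Finset.mem_univ _, fun h' => h h'.symm⟩)
  have hne : ∀ r ∈ K, j r ≠ j' r := fun r hr => (Finset.mem_filter.1 hr).2
  have hmeas : Measurable fun y : Fin d → ℕ → E => g (evalTuple j y) * g (evalTuple j' y) := by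
    fun_prop
  -- If `j` and `j'` differ throughout `J`, the factors are conditionally independent and give the
  -- square. Otherwise `K` is a proper subset: integrating over `K` first splits the product, the
  -- bound `hgJ` replaces one factor by `N ^ (-|K|)`, and integrating the other over `J \ K` leaves
  -- a single marginal over `J`.
  rcases eq_or_ne K J with h | h
  · rw [← h, lmarginal_comp_evalTuple_mul μ hg hg K hne y, hcongr hjj', ← sq,
      hcongr (l := j) (l' := i) (fun r hr => hj r (h ▸ hr))]
    exact le_self_add
  · refine le_trans ?_ le_add_self
    have hss : K ⊂ J := Finset.ssubset_iff_subset_ne.2 ⟨hKJ, h⟩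
    rw [prod_ite_inv_eq, ← hK]
    have hunion : J = J \ K ∪ K := (Finset.sdiff_union_of_subset hKJ).symm
    have hb : ∀ x, lmarginal (fun _ => μ) K g x ≤ ((N : ENNReal) ^ K.card)⁻¹ := by
      intro x
      rw [← one_div, ENNReal.le_div_iff_mul_le (Or.inl (by simp [hN])) (Or.inl (by simp)), mul_comm]
      exact hgJ K hss x
    calc lmarginal (fun _ => seqLaw μ) J (fun y => g (evalTuple j y) * g (evalTuple j' y)) y
        = lmarginal (fun _ => seqLaw μ) (J \ K) (lmarginal (fun _ => seqLaw μ) K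
            (fun y => g (evalTuple j y) * g (evalTuple j' y))) y := by
          rw [← lmarginal_union _ _ hmeas Finset.sdiff_disjoint, ← hunion]
      _ ≤ lmarginal (fun _ => seqLaw μ) (J \ K) (fun y => ((N : ENNReal) ^ K.card)⁻¹
            * lmarginal (fun _ => μ) K g (evalTuple j y)) y := by
          refine lmarginal_mono (fun y => ?_) y
          rw [lmarginal_comp_evalTuple_mul μ hg hg K hne y]
          rw [hcongr hjj', mul_comm]
          gcongr
          · exact hb _
      _ = ((N : ENNReal) ^ K.card)⁻¹ * lmarginal (fun _ => seqLaw μ) (J \ K) (fun y =>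
            lmarginal (fun _ => μ) K g (evalTuple j y)) y := by
          unfold lmarginal
          rw [lintegral_const_mul]
          exact ((hg.lmarginal (fun _ => μ) (s := K)).comp (measurable_evalTuple j)).comp
            measurable_updateFinset
      _ = ((N : ENNReal) ^ K.card)⁻¹ * lmarginal (fun _ => μ) J g (evalTuple i y) := by
          rw [lmarginal_comp_evalTuple μ j (hg.lmarginal _),
            ← lmarginal_union _ _ hg Finset.sdiff_disjoint, ← hunion, hcongr hj]

/-- Conditional lower bound for the tail of a nonnegative decoupled U-statistic whose lower order
marginals are small. -/
theorem sq_le_lmarginal_sum_evalTuple {N : ℕ} (hN : N ≠ 0) {J : Finset (Fin d)} (hJ : J.Nonempty)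
    {g : (Fin d → E) → ENNReal} (hg : Measurable g)
    (hgJ : ∀ K ⊂ J, ∀ x, (N : ENNReal) ^ K.card * lmarginal (fun _ => μ) K g x ≤ 1)
    {i : Fin d → ℕ} (hi : i ∈ cubeIndices d N) (y : Fin d → ℕ → E) {m : ENNReal}
    (hm : (N : ENNReal) ^ J.card * lmarginal (fun _ => μ) J g (evalTuple i y) = m) :
    m ≠ ⊤ ∧ m ^ 2 ≤ 4 * (m ^ 2 + 2 ^ d * m) * lmarginal (fun _ => seqLaw μ) J
      ({y | m / 2 ≤ ∑ j ∈ cubeIndices d N, g (evalTuple j y)}.indicator 1) y := by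
  classical
  have hg1 : ∀ x, g x ≤ 1 := fun x => by
    simpa using hgJ ∅ (Finset.empty_ssubset.2 hJ) x
  set q := lmarginal (fun _ => μ) J g (evalTuple i y) with hq
  have hq1 : q ≤ 1 := by
    rw [hq]
    unfold lmarginal
    refine (lintegral_mono fun z => hg1 _).trans ?_
    simp
  have hmtop : m ≠ ⊤ := by
    rw [← hm]
    exact ENNReal.mul_ne_top (by simp) (ne_top_of_le_ne_top ENNReal.one_ne_top hq1)
  refine ⟨hmtop, ?_⟩
  -- The sum is restricted to the face of the cube through `i` with free coordinates `J`. It has `N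
  -- ^ |J|` points, all with conditional mean `q`, so the mean is `m`.
  set t : Fin d → Finset ℕ := fun r => if r ∈ J then Finset.Icc 1 N else {i r} with ht
  set T := Fintype.piFinset t with hT
  have hTi : ∀ j ∈ T, ∀ r ∉ J, j r = i r := by
    intro j hj r hr
    have := Fintype.mem_piFinset.1 hj r
    simpa [ht, hr] using this
  have hTC : T ⊆ cubeIndices d N := by
    intro j hj
    refine Fintype.mem_piFinset.2 fun r => ?_
    by_cases hr : r ∈ J
    · have := Fintype.mem_piFinset.1 hj r
      simpa only [ht, if_pos hr] using this
    · rw [hTi j hj r hr]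
      exact Fintype.mem_piFinset.1 hi r
  have hcard : (T.card : ENNReal) = (N : ENNReal) ^ J.card := by
    rw [hT, Fintype.card_piFinset]
    have : ∀ r, (t r).card = if r ∈ J then N else 1 := by
      intro r
      by_cases hr : r ∈ J <;> simp [ht, hr]
    simp_rw [this]
    rw [Finset.prod_ite]
    simp
  have hmZ : Measurable fun z : (r : J) → ℕ → E =>
      ∑ j ∈ T, g (evalTuple j (Function.updateFinset y J z)) := by
    have : ∀ j, Measurable fun z : (r : J) → ℕ → E =>
        g (evalTuple j (Function.updateFinset y J z)) := fun j =>
      (hg.comp (measurable_evalTuple j)).comp measurable_updateFinset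
    fun_prop
  have hmZj : ∀ j, Measurable fun z : (r : J) → ℕ → E =>
        g (evalTuple j (Function.updateFinset y J z)) := fun j =>
      (hg.comp (measurable_evalTuple j)).comp measurable_updateFinset
  have h1 : ∫⁻ z, ∑ j ∈ T, g (evalTuple j (Function.updateFinset y J z))
      ∂(Measure.pi fun _ : J => seqLaw μ) = m := by
    rw [lintegral_finsetSum _ fun j _ => hmZj j]
    have : ∀ j ∈ T, ∫⁻ z, g (evalTuple j (Function.updateFinset y J z))
        ∂(Measure.pi fun _ : J => seqLaw μ) = q := by
      intro j hj
      refine (lmarginal_comp_evalTuple μ j hg J y).trans ?_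
      refine lmarginal_congr _ _ fun r hr => ?_
      simp [evalTuple, hTi j hj r hr]
    rw [Finset.sum_congr rfl this, Finset.sum_const, nsmul_eq_mul, hcard, hm]
  have h2 : ∫⁻ z, (∑ j ∈ T, g (evalTuple j (Function.updateFinset y J z))) ^ 2
      ∂(Measure.pi fun _ : J => seqLaw μ) ≤ m ^ 2 + 2 ^ d * m := by
    simp_rw [sq (∑ j ∈ T, _), Finset.sum_mul_sum]
    rw [lintegral_finsetSum _ fun j _ =>
      Finset.measurable_fun_sum _ fun j' _ => (hmZj j).fun_mul (hmZj j')]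
    have hrow : ∀ j ∈ T, ∫⁻ z, ∑ j' ∈ T, g (evalTuple j (Function.updateFinset y J z))
        * g (evalTuple j' (Function.updateFinset y J z)) ∂(Measure.pi fun _ : J => seqLaw μ)
        ≤ (N : ENNReal) ^ J.card * q ^ 2 + 2 ^ d * q := by
      intro j hj
      rw [lintegral_finsetSum _ fun j' _ => (hmZj j).fun_mul (hmZj j')]
      calc ∑ j' ∈ T, ∫⁻ z, g (evalTuple j (Function.updateFinset y J z))
            * g (evalTuple j' (Function.updateFinset y J z)) ∂(Measure.pi fun _ : J => seqLaw μ)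
          ≤ ∑ j' ∈ T, (q ^ 2 + (∏ r, (if j r = j' r then (1 : ENNReal) else (N : ENNReal)⁻¹))
              * q) := by
            refine Finset.sum_le_sum fun j' hj' => ?_
            exact lmarginal_evalTuple_mul_le μ hN hg hgJ (hTi j hj) (hTi j' hj') y
        _ = (N : ENNReal) ^ J.card * q ^ 2
            + (∏ r, ∑ b ∈ t r, (if j r = b then (1 : ENNReal) else (N : ENNReal)⁻¹)) * q := by
            rw [Finset.sum_add_distrib, Finset.sum_const, nsmul_eq_mul, hcard, ← Finset.sum_mul,
              Finset.prod_univ_sum]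
        _ ≤ _ := by
            gcongr
            -- Each coordinate contributes at most `1` from `b = j r` and at most `N` terms `1 / N`,
            -- whence `2 ^ d`.
            calc ∏ r, ∑ b ∈ t r, (if j r = b then (1 : ENNReal) else (N : ENNReal)⁻¹)
                ≤ ∏ _r : Fin d, (2 : ENNReal) := by
                  refine Finset.prod_le_prod' fun r _ => ?_
                  calc ∑ b ∈ t r, (if j r = b then (1 : ENNReal) else (N : ENNReal)⁻¹)
                      ≤ ∑ b ∈ t r, ((if j r = b then (1 : ENNReal) else 0) + (N : ENNReal)⁻¹) := by
                        refine Finset.sum_le_sum fun b _ => ?_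
                        split_ifs
                        · exact le_self_add
                        · exact le_add_self
                    _ ≤ 1 + N * (N : ENNReal)⁻¹ := by
                        rw [Finset.sum_add_distrib, Finset.sum_ite_eq, Finset.sum_const,
                          nsmul_eq_mul]
                        gcongr
                        · split_ifs <;> simp
                        · by_cases hr : r ∈ J
                          · simp [ht, hr]
                          · simp only [ht, hr, if_false, Finset.card_singleton]
                            exact Nat.one_le_iff_ne_zero.2 hN
                    _ = 2 := by
                        rw [ENNReal.mul_inv_cancel (by simp [hN]) (by simp)]
                        norm_num
              _ = 2 ^ d := by simp
    refine (Finset.sum_le_sum hrow).trans ?_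
    rw [Finset.sum_const, nsmul_eq_mul, hcard, ← hm]
    refine le_of_eq ?_
    ring
  refine (sq_le_four_mul_measure_half_le _ hmZ h1 h2 (by finiteness) hmtop).trans ?_
  gcongr
  unfold lmarginal
  refine (le_of_eq (lintegral_indicator_one (measurableSet_le measurable_const hmZ)).symm).trans ?_
  refine lintegral_mono fun z => ?_
  by_cases hz : m / 2 ≤ ∑ j ∈ T, g (evalTuple j (Function.updateFinset y J z))
  · rw [Set.indicator_of_mem (by exact hz), Set.indicator_of_mem
      (by exact hz.trans (Finset.sum_le_sum_of_subset hTC))]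
    exact le_rfl
  · rw [Set.indicator_of_notMem (by exact hz)]
    exact zero_le

end SecondMoment

/-! ### Truncation sets: marginal bounds, exit probabilities, truncated moments -/

section Truncation

variable {E : Type*} [MeasurableSpace E] {d : ℕ}

theorem lmarginal_const_mul (ν : Fin d → Measure E) (s : Finset (Fin d)) (c : ENNReal)
    {f : (Fin d → E) → ENNReal} (hf : Measurable f) (x : Fin d → E) :
    lmarginal ν s (fun x => c * f x) x = c * lmarginal ν s f x :=
  lintegral_const_mul c (f := fun z => f (Function.updateFinset x s z))
    (hf.comp measurable_updateFinset)

variable (μ : Measure E)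

/-- With level 0 equal to the whole space, level 1 obeys the general recursion: the only set with no
elements is `∅`, and integrating over no coordinate is evaluation. -/
theorem mem_truncSet_succ {h : (Fin d → E) → ℝ} {γ : ℕ → ℝ} {k l : ℕ} {x : Fin d → E} :
    x ∈ truncSet μ h γ k (l + 1) ↔ x ∈ truncSet μ h γ k l ∧ ∀ I : Finset (Fin d), I.card = l →
      (2 : ENNReal) ^ (k * l) * lmarginal (fun _ : Fin d => μ) I
        ((truncSet μ h γ k l).indicator fun y => ENNReal.ofReal (h y ^ 2)) x
          ≤ ENNReal.ofReal (γ (2 ^ k) ^ 2) := by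
  cases l with
  | zero =>
    have : (∀ I : Finset (Fin d), I.card = 0 → (2 : ENNReal) ^ (k * 0) *
        lmarginal (fun _ : Fin d => μ) I
        ((truncSet μ h γ k 0).indicator fun y => ENNReal.ofReal (h y ^ 2)) x
          ≤ ENNReal.ofReal (γ (2 ^ k) ^ 2)) ↔
        ENNReal.ofReal (h x ^ 2) ≤ ENNReal.ofReal (γ (2 ^ k) ^ 2) := by
      simp [Finset.card_eq_zero, truncSet]
    rw [this, ENNReal.ofReal_le_ofReal_iff (sq_nonneg _)]
    simp [truncSet]
  | succ l => rfl

theorem truncSet_antitone (h : (Fin d → E) → ℝ) (γ : ℕ → ℝ) (k : ℕ) :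
    Antitone (truncSet μ h γ k) :=
  antitone_nat_of_succ_le fun _ _ hx => ((mem_truncSet_succ μ).1 hx).1

variable [IsProbabilityMeasure μ]

/-- The law of `d` independent i.i.d. sequences with common law `μ`. -/
noncomputable def decoupledLaw (d : ℕ) : Measure (Fin d → ℕ → E) :=
  Measure.pi fun _ : Fin d => seqLaw μ

instance : IsProbabilityMeasure (decoupledLaw μ d) := by
  unfold decoupledLaw
  infer_instance

/-- Tower property: the marginal no longer depends on the coordinates in `J`. -/
theorem lintegral_lmarginal_decoupledLaw (J : Finset (Fin d)) {f : (Fin d → ℕ → E) → ENNReal}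
    (hf : Measurable f) :
    ∫⁻ y, lmarginal (fun _ => seqLaw μ) J f y ∂decoupledLaw μ d = ∫⁻ y, f y ∂decoupledLaw μ d := by
  refine lintegral_eq_of_lmarginal_eq J (hf.lmarginal _) hf ?_
  funext y
  have : ∀ z : (r : J) → ℕ → E,
      lmarginal (fun _ => seqLaw μ) J f (Function.updateFinset y J z)
        = lmarginal (fun _ => seqLaw μ) J f y := fun z =>
    lmarginal_congr _ _ fun r hr => by simp [Function.updateFinset, hr]
  conv_lhs => unfold lmarginal
  change ∫⁻ z, lmarginal (fun _ => seqLaw μ) J f (Function.updateFinset y J z) ∂_ = _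
  simp_rw [this]
  simp

theorem measurableSet_truncSet {h : (Fin d → E) → ℝ} (hh : Measurable h) (γ : ℕ → ℝ) (k l : ℕ) :
    MeasurableSet (truncSet μ h γ k l) := by
  induction l with
  | zero => exact MeasurableSet.univ
  | succ l ih =>
    have : truncSet μ h γ k (l + 1) = truncSet μ h γ k l ∩ ⋂ I : Finset (Fin d),
        ⋂ _ : I.card = l, {x | (2 : ENNReal) ^ (k * l) * lmarginal (fun _ : Fin d => μ) I
        ((truncSet μ h γ k l).indicator fun y => ENNReal.ofReal (h y ^ 2)) x
          ≤ ENNReal.ofReal (γ (2 ^ k) ^ 2)} := by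
      ext x
      rw [mem_truncSet_succ]
      simp
    rw [this]
    refine ih.inter (MeasurableSet.iInter fun I => MeasurableSet.iInter fun _ => ?_)
    exact measurableSet_le (measurable_const.mul (Measurable.lmarginal _
      ((hh.pow_const 2).ennreal_ofReal.indicator ih))) measurable_const

/-- The marginals of order less than `l` of `h² / γ²` restricted to a part of `A_{k,l}` are
bounded. -/
theorem pow_mul_lmarginal_indicator_le {h : (Fin d → E) → ℝ} (hh : Measurable h) {γ : ℕ → ℝ}
    {k l N : ℕ} (hγ : 0 < γ (2 ^ k)) (hN : N ≤ 2 ^ k) {B : Set (Fin d → E)}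
    (hB : MeasurableSet B) (hBl : B ⊆ truncSet μ h γ k l) {K : Finset (Fin d)} (hK : K.card < l)
    (x : Fin d → E) :
    (N : ENNReal) ^ K.card * lmarginal (fun _ : Fin d => μ) K (fun x =>
      (ENNReal.ofReal (γ (2 ^ k) ^ 2))⁻¹ * B.indicator (fun y => ENNReal.ofReal (h y ^ 2)) x) x
      ≤ 1 := by
  set a := ENNReal.ofReal (γ (2 ^ k) ^ 2) with ha
  have ha0 : a ≠ 0 := by simpa [ha] using hγ.ne'
  have hat : a ≠ ⊤ := ENNReal.ofReal_ne_top
  have hG : Measurable (B.indicator fun y => ENNReal.ofReal (h y ^ 2)) :=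
    (hh.pow_const 2).ennreal_ofReal.indicator hB
  have hconst : ∀ x, lmarginal (fun _ : Fin d => μ) K (fun x =>
      a⁻¹ * B.indicator (fun y => ENNReal.ofReal (h y ^ 2)) x) x
      = a⁻¹ * lmarginal (fun _ : Fin d => μ) K
        (B.indicator fun y => ENNReal.ofReal (h y ^ 2)) x := by
    intro x
    exact lmarginal_const_mul _ _ _ hG x
  -- The marginal depends on `x` only through the fibre over the coordinates outside `K`. If the
  -- fibre meets `B`, then `x` may be moved to a point of `B`, where the constraint defining level
  -- `|K| + 1` applies; if it misses `B`, the marginal is zero.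
  by_cases hex : ∃ z : (r : K) → E, Function.updateFinset x K z ∈ B
  · obtain ⟨z, hz⟩ := hex
    have hx' : Function.updateFinset x K z ∈ truncSet μ h γ k (K.card + 1) :=
      truncSet_antitone μ h γ k (Nat.succ_le_of_lt hK) (hBl hz)
    have h1 := ((mem_truncSet_succ μ).1 hx').2 K rfl
    rw [lmarginal_congr (y := Function.updateFinset x K z) _ _
      fun r hr => by simp [Function.updateFinset, hr], hconst]
    have h2 : lmarginal (fun _ : Fin d => μ) K (B.indicator fun y => ENNReal.ofReal (h y ^ 2))
        (Function.updateFinset x K z) ≤ lmarginal (fun _ : Fin d => μ) K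
        ((truncSet μ h γ k K.card).indicator fun y => ENNReal.ofReal (h y ^ 2))
        (Function.updateFinset x K z) :=
      lmarginal_mono (fun y => Set.indicator_le_indicator_of_subset
        (hBl.trans (truncSet_antitone μ h γ k hK.le)) (fun _ => zero_le) y) _
    have h3 : (N : ENNReal) ^ K.card ≤ 2 ^ (k * K.card) := by
      rw [pow_mul]
      gcongr
      exact_mod_cast hN
    calc _ = a⁻¹ * ((N : ENNReal) ^ K.card * lmarginal (fun _ : Fin d => μ) K
          (B.indicator fun y => ENNReal.ofReal (h y ^ 2)) (Function.updateFinset x K z)) := by ring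
      _ ≤ a⁻¹ * a := by
          gcongr
          exact (mul_le_mul' h3 h2).trans h1
      _ = 1 := ENNReal.inv_mul_cancel ha0 hat
  · have h0 : lmarginal (fun _ : Fin d => μ) K
        (B.indicator fun y => ENNReal.ofReal (h y ^ 2)) x = 0 := by
      unfold lmarginal
      have : ∀ z : (r : K) → E, B.indicator (fun y => ENNReal.ofReal (h y ^ 2))
          (Function.updateFinset x K z) = 0 := fun z =>
        Set.indicator_of_notMem (fun hz => hex ⟨z, hz⟩) _
      simp [this]
    rw [hconst, h0]
    simp

/-- Leaving the truncation set forces the decoupled sum of squares to be large, up to a constant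
factor in probability. -/
theorem decoupledLaw_exists_notMem_truncSet_le {h : (Fin d → E) → ℝ} (hh : Measurable h)
    {γ : ℕ → ℝ} {k : ℕ} (hγ : 0 < γ (2 ^ k)) :
    decoupledLaw μ d {y | ∃ i ∈ cubeIndices d (2 ^ k), evalTuple i y ∉ truncSet μ h γ k d}
      ≤ 2 ^ d * (4 * (1 + 2 ^ d)) * decoupledLaw μ d {y | ENNReal.ofReal (γ (2 ^ k) ^ 2) / 2
        ≤ ∑ i ∈ cubeIndices d (2 ^ k), ENNReal.ofReal (h (evalTuple i y) ^ 2)} := by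
  set N := 2 ^ k with hN
  set a := ENNReal.ofReal (γ N ^ 2) with ha
  have ha0 : a ≠ 0 := by simpa [ha] using hγ.ne'
  have hat : a ≠ ⊤ := ENNReal.ofReal_ne_top
  set S : Set (Fin d → ℕ → E) :=
    {y | a / 2 ≤ ∑ i ∈ cubeIndices d N, ENNReal.ofReal (h (evalTuple i y) ^ 2)} with hS
  have hSm : MeasurableSet S := measurableSet_le measurable_const (by fun_prop)
  -- `F J` is the event that the constraint attached to `J` fails at some sampled point. A point
  -- outside `A_{k,d}` violates at least one of the constraints, and there are `2 ^ d` sets `J`.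
  set F : Finset (Fin d) → Set (Fin d → ℕ → E) := fun J => {y | ∃ i ∈ cubeIndices d N,
    a < (2 : ENNReal) ^ (k * J.card) * lmarginal (fun _ : Fin d => μ) J
      ((truncSet μ h γ k J.card).indicator fun y => ENNReal.ofReal (h y ^ 2)) (evalTuple i y)}
    with hF
  have hsub : {y | ∃ i ∈ cubeIndices d N, evalTuple i y ∉ truncSet μ h γ k d}
      ⊆ ⋃ J ∈ (Finset.univ : Finset (Finset (Fin d))), F J := by
    rintro y ⟨i, hi, hy⟩
    have hmono : ∀ l, evalTuple i y ∉ truncSet μ h γ k l → ∃ J : Finset (Fin d), y ∈ F J := by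
      intro l
      induction l with
      | zero => exact fun h => absurd (Set.mem_univ _) h
      | succ l ih =>
        intro hl
        by_cases hm : evalTuple i y ∈ truncSet μ h γ k l
        · rw [mem_truncSet_succ, not_and] at hl
          obtain ⟨J, hJ⟩ := not_forall.1 (hl hm)
          obtain ⟨rfl, hJ⟩ := Classical.not_imp.1 hJ
          exact ⟨J, i, hi, not_le.1 hJ⟩
        · exact ih hm
    obtain ⟨J, hJ⟩ := hmono d hy
    exact Set.mem_biUnion (Finset.mem_univ J) hJ
  have hFJ : ∀ J, decoupledLaw μ d (F J) ≤ 4 * (1 + 2 ^ d) * decoupledLaw μ d S := by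
    intro J
    rcases J.eq_empty_or_nonempty with rfl | hJ
    · have : F ∅ ⊆ S := by
        rintro y ⟨i, hi, hy⟩
        simp only [Finset.card_empty, mul_zero, pow_zero, lmarginal_empty, one_mul] at hy
        calc a / 2 ≤ a := ENNReal.half_le_self
          _ ≤ ENNReal.ofReal (h (evalTuple i y) ^ 2) :=
            hy.le.trans (Set.indicator_le_self' (fun _ _ => zero_le) _)
          _ ≤ _ := Finset.single_le_sum
            (f := fun i => ENNReal.ofReal (h (evalTuple i y) ^ 2)) (fun _ _ => zero_le) hi
      refine (measure_mono this).trans (le_mul_of_one_le_left zero_le ?_)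
      calc (1 : ENNReal) ≤ 4 * 1 := by norm_num
        _ ≤ _ := by gcongr; exact le_self_add
    · have hTm := measurableSet_truncSet μ hh γ k J.card
      set g : (Fin d → E) → ENNReal := fun x =>
        a⁻¹ * (truncSet μ h γ k J.card).indicator (fun y => ENNReal.ofReal (h y ^ 2)) x with hg
      have hind : Measurable ((truncSet μ h γ k J.card).indicator
          fun y => ENNReal.ofReal (h y ^ 2)) := (hh.pow_const 2).ennreal_ofReal.indicator hTm
      have hgm : Measurable g := measurable_const.mul hind
      have hgJ : ∀ K ⊂ J, ∀ x, (N : ENNReal) ^ K.card * lmarginal (fun _ => μ) K g x ≤ 1 :=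
        fun K hK x => pow_mul_lmarginal_indicator_le μ hh hγ le_rfl hTm subset_rfl
          (Finset.card_lt_card hK) x
      have hpt : ∀ y, (F J).indicator 1 y
          ≤ 4 * (1 + 2 ^ d) * lmarginal (fun _ => seqLaw μ) J (S.indicator 1) y := by
        intro y
        by_cases hy : y ∈ F J
        swap
        · rw [Set.indicator_of_notMem hy]
          exact zero_le
        rw [Set.indicator_of_mem hy, Pi.one_apply]
        obtain ⟨i, hi, hy⟩ := hy
        obtain ⟨hmt, hm⟩ := sq_le_lmarginal_sum_evalTuple μ (by positivity) hJ hgm hgJ hi y rfl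
        set m := (N : ENNReal) ^ J.card * lmarginal (fun _ => μ) J g (evalTuple i y) with hmdef
        -- Failure of the constraint is exactly `m > 1` after normalization. Then `m ≤ m²`, so `m² +
        -- 2 ^ d m ≤ (1 + 2 ^ d) m²`, and `m²` cancels from the Paley–Zygmund bound.
        have hm1 : 1 < m := by
          have : m = a⁻¹ * ((2 : ENNReal) ^ (k * J.card) * lmarginal (fun _ : Fin d => μ) J
              ((truncSet μ h γ k J.card).indicator fun y => ENNReal.ofReal (h y ^ 2))
              (evalTuple i y)) := by
            rw [hmdef, hg, pow_mul, hN, lmarginal_const_mul _ _ _ hind]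
            push_cast
            ring
          rw [this, ← ENNReal.inv_mul_cancel ha0 hat]
          exact ENNReal.mul_lt_mul_right (by simpa using hat) (by simpa using ha0) hy
        have hm0 : m ≠ 0 := (zero_lt_one.trans hm1).ne'
        set p := lmarginal (fun _ => seqLaw μ) J (S.indicator 1) y with hp
        have hple : lmarginal (fun _ => seqLaw μ) J ({y | m / 2 ≤ ∑ j ∈ cubeIndices d N,
            g (evalTuple j y)}.indicator 1) y ≤ p := by
          refine lmarginal_mono (Set.indicator_le_indicator_of_subset ?_ fun _ => zero_le) y
          intro y' hy'
          have hsum : ∑ j ∈ cubeIndices d N, g (evalTuple j y')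
              ≤ a⁻¹ * ∑ j ∈ cubeIndices d N, ENNReal.ofReal (h (evalTuple j y') ^ 2) := by
            rw [Finset.mul_sum]
            refine Finset.sum_le_sum fun j _ => ?_
            exact mul_le_mul_right (Set.indicator_le_self' (fun _ _ => zero_le) _) _
          have h1 : 1 / 2 ≤ a⁻¹ * ∑ j ∈ cubeIndices d N,
              ENNReal.ofReal (h (evalTuple j y') ^ 2) := by
            refine le_trans ?_ ((show m / 2 ≤ _ from hy').trans hsum)
            gcongr
          change a / 2 ≤ _
          calc a / 2 = a * (1 / 2) := by rw [ENNReal.div_eq_inv_mul, one_div, mul_comm]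
            _ ≤ a * (a⁻¹ * ∑ j ∈ cubeIndices d N, ENNReal.ofReal (h (evalTuple j y') ^ 2)) := by
              gcongr
            _ = _ := by rw [← mul_assoc, ENNReal.mul_inv_cancel ha0 hat, one_mul]
        refine (ENNReal.mul_le_mul_iff_right (pow_ne_zero 2 hm0)
          (ENNReal.pow_ne_top hmt)).1 ?_
        calc m ^ 2 * 1 ≤ 4 * (m ^ 2 + 2 ^ d * m) * p := by
              rw [mul_one]
              exact hm.trans (mul_le_mul_right hple _)
          _ ≤ 4 * (m ^ 2 + 2 ^ d * (m * m)) * p := by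
              gcongr
              exact le_mul_of_one_le_left zero_le hm1.le
          _ = _ := by ring
      have hFm : MeasurableSet (F J) := by
        have : F J = ⋃ i ∈ cubeIndices d N, {y | a < (2 : ENNReal) ^ (k * J.card)
            * lmarginal (fun _ : Fin d => μ) J ((truncSet μ h γ k J.card).indicator
              fun y => ENNReal.ofReal (h y ^ 2)) (evalTuple i y)} := by
          ext y
          simp [hF]
        rw [this]
        refine Finset.measurableSet_biUnion _ fun i _ => measurableSet_lt measurable_const ?_
        exact measurable_const.mul ((hind.lmarginal _).comp (measurable_evalTuple i))
      calc decoupledLaw μ d (F J) = ∫⁻ y, (F J).indicator 1 y ∂decoupledLaw μ d :=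
            (lintegral_indicator_one hFm).symm
        _ ≤ ∫⁻ y, 4 * (1 + 2 ^ d) * lmarginal (fun _ => seqLaw μ) J (S.indicator 1) y
            ∂decoupledLaw μ d := lintegral_mono hpt
        _ = 4 * (1 + 2 ^ d) * decoupledLaw μ d S := by
            rw [lintegral_const_mul _ (Measurable.lmarginal _ (measurable_one.indicator hSm)),
              lintegral_lmarginal_decoupledLaw μ J (measurable_one.indicator hSm),
              lintegral_indicator_one hSm]
  calc _ ≤ decoupledLaw μ d (⋃ J ∈ (Finset.univ : Finset (Finset (Fin d))), F J) :=
        measure_mono hsub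
    _ ≤ ∑ J : Finset (Fin d), decoupledLaw μ d (F J) := measure_biUnion_finset_le _ _
    _ ≤ ∑ _J : Finset (Fin d), 4 * (1 + 2 ^ d) * decoupledLaw μ d S :=
        Finset.sum_le_sum fun J _ => hFJ J
    _ = _ := by
        rw [Finset.sum_const, nsmul_eq_mul, Finset.card_univ, Fintype.card_finset,
          Fintype.card_fin]
        push_cast
        ring

/-- The normalized second moment on a part `B` of the truncation set is controlled by the
probability that the decoupled sample visits `B`. -/
theorem pow_mul_lintegral_indicator_le (hd : 1 ≤ d) {h : (Fin d → E) → ℝ} (hh : Measurable h)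
    {γ : ℕ → ℝ} {k N : ℕ} (hγ : 0 < γ (2 ^ k)) (hN0 : N ≠ 0) (hN : N ≤ 2 ^ k)
    {B : Set (Fin d → E)} (hB : MeasurableSet B) (hBd : B ⊆ truncSet μ h γ k d) {m : ENNReal}
    (hm : (N : ENNReal) ^ d * ∫⁻ x, (ENNReal.ofReal (γ (2 ^ k) ^ 2))⁻¹
      * B.indicator (fun y => ENNReal.ofReal (h y ^ 2)) x ∂(Measure.pi fun _ => μ) = m) :
    m ≠ ⊤ ∧ m ≤ 4 * (m + 2 ^ d)
      * decoupledLaw μ d {y | ∃ i ∈ cubeIndices d N, evalTuple i y ∈ B} := by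
  have : Nonempty (Fin d) := ⟨⟨0, hd⟩⟩
  set g : (Fin d → E) → ENNReal := fun x => (ENNReal.ofReal (γ (2 ^ k) ^ 2))⁻¹
      * B.indicator (fun y => ENNReal.ofReal (h y ^ 2)) x with hg
  have hgm : Measurable g :=
    measurable_const.mul ((hh.pow_const 2).ennreal_ofReal.indicator hB)
  have hgJ : ∀ K ⊂ (Finset.univ : Finset (Fin d)), ∀ x,
      (N : ENNReal) ^ K.card * lmarginal (fun _ => μ) K g x ≤ 1 := by
    intro K hK x
    refine pow_mul_lmarginal_indicator_le μ hh hγ hN hB hBd ?_ x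
    simpa using Finset.card_lt_card hK
  have hi : (fun _ => 1 : Fin d → ℕ) ∈ cubeIndices d N :=
    Fintype.mem_piFinset.2 fun _ => Finset.mem_Icc.2 ⟨le_rfl, Nat.one_le_iff_ne_zero.2 hN0⟩
  obtain ⟨y⟩ : Nonempty (Fin d → ℕ → E) := (decoupledLaw μ d).nonempty_of_neZero
  -- All coordinates are integrated, so the base points `i` and `y` are immaterial. A sum at least
  -- `m / 2 > 0` requires a visit to `B`, and one factor `m` cancels.
  obtain ⟨hmt, hle⟩ := sq_le_lmarginal_sum_evalTuple μ hN0 Finset.univ_nonempty hgm hgJ hi y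
    (m := m) (by rw [lmarginal_univ, ← hm]; simp)
  refine ⟨hmt, ?_⟩
  rcases eq_or_ne m 0 with hm0 | hm0
  · rw [hm0]
    exact zero_le
  rw [lmarginal_univ, lintegral_indicator_one
    (measurableSet_le measurable_const (by fun_prop))] at hle
  have hsub : {y | m / 2 ≤ ∑ j ∈ cubeIndices d N, g (evalTuple j y)}
      ⊆ {y | ∃ i ∈ cubeIndices d N, evalTuple i y ∈ B} := by
    intro y hy
    by_contra hcon
    have h0 : ∑ j ∈ cubeIndices d N, g (evalTuple j y) = 0 := by
      refine Finset.sum_eq_zero fun j hj => ?_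
      rw [hg]
      simp only
      rw [Set.indicator_of_notMem (fun h => hcon ⟨j, hj, h⟩), mul_zero]
    rw [Set.mem_ofPred_eq, h0] at hy
    exact hm0 (by simpa using hy)
  refine (ENNReal.mul_le_mul_iff_right hm0 hmt).1 ?_
  calc m * m = m ^ 2 := (sq m).symm
    _ ≤ 4 * (m ^ 2 + 2 ^ d * m)
        * decoupledLaw μ d {y | ∃ i ∈ cubeIndices d N, evalTuple i y ∈ B} :=
      hle.trans (mul_le_mul_right (measure_mono hsub) _)
    _ = _ := by ring

end Truncation

/-! ### Laws of samples; comparison of coupled and decoupled families -/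

section Laws

variable {Ω E ι : Type*} [MeasurableSpace Ω] [MeasurableSpace E] {d : ℕ}
  {P : Measure Ω} {μ : Measure E} {X : ι → Ω → E} {ε : ι → Ω → ℝ}

theorem IsSymmetrizedSample.map_comp_injective (hX : IsSymmetrizedSample P μ X ε) {κ : Type*}
    {f : κ → ι} (hf : Function.Injective f) :
    P.map (fun ω k => X (f k) ω) = Measure.infinitePi fun _ => μ := by
  rw [(hX.indep_X.precomp hf).map_fun_eq_infinitePi_map fun k => hX.measurable_X (f k)]
  exact congrArg _ (funext fun k => hX.law_X (f k))

variable [IsProbabilityMeasure μ]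

theorem infinitePi_map_curry_eq_decoupledLaw :
    (Measure.infinitePi fun _ : Fin d × ℕ => μ).map (fun x r j => x (r, j)) = decoupledLaw μ d := by
  unfold decoupledLaw seqLaw
  rw [← Measure.infinitePi_eq_pi]
  exact Measure.infinitePi_map_curry (fun (_ : Fin d) (_ : ℕ) => μ)

theorem IsSymmetrizedSample.map_decoupled (hX : IsSymmetrizedSample P μ X ε)
    {f : Fin d × ℕ → ι} (hf : Function.Injective f) :
    P.map (fun ω r j => X (f (r, j)) ω) = decoupledLaw μ d := by
  rw [← infinitePi_map_curry_eq_decoupledLaw, ← hX.map_comp_injective hf,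
    Measure.map_map (by fun_prop) (measurable_pi_lambda _ fun k => hX.measurable_X _)]
  rfl

/-- Reading time `j` from the sequence selected by the color `c j` uses each time once, so the
entries read are again i.i.d. -/
theorem decoupledLaw_map_diagonal (c : ℕ → Fin d) :
    (decoupledLaw μ d).map (fun y j => y (c j) j) = seqLaw μ := by
  rw [← infinitePi_map_curry_eq_decoupledLaw, Measure.map_map (by fun_prop) (by fun_prop)]
  exact Measure.map_infinitePi_infinitePi_of_inj (P := fun _ : Fin d × ℕ => μ)
    (f := fun j => (c j, j)) fun a b h => congrArg Prod.snd h

theorem decoupledLaw_map_reindex {f : Fin d → ℕ → ℕ} (hf : ∀ r, Function.Injective (f r)) :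
    (decoupledLaw μ d).map (fun y r j => y r (f r j)) = decoupledLaw μ d := by
  conv_lhs => rw [← infinitePi_map_curry_eq_decoupledLaw, Measure.map_map (by fun_prop)
    (by fun_prop)]
  have h : ((fun (y : Fin d → ℕ → E) r j => y r (f r j)) ∘ fun (x : Fin d × ℕ → E) r j => x (r, j))
      = (fun (x : Fin d × ℕ → E) r j => x (r, j))
        ∘ fun (x : Fin d × ℕ → E) p => x (p.1, f p.1 p.2) := rfl
  have hinj : Function.Injective fun p : Fin d × ℕ => (p.1, f p.1 p.2) := by
    rintro ⟨r, j⟩ ⟨r', j'⟩ h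
    simp only [Prod.mk.injEq] at h
    obtain ⟨rfl, h⟩ := h
    rw [hf r h]
  have hmap := Measure.map_infinitePi_infinitePi_of_inj (P := fun _ : Fin d × ℕ => μ) hinj
  rw [h, ← Measure.map_map (by fun_prop) (by fun_prop), hmap,
    infinitePi_map_curry_eq_decoupledLaw]

/-- Euclidean division of `i r - 1` by `n` cuts the large cube into `M ^ d` translates of the small
one; the shift by 1 is due to indices starting at 1. -/
theorem sum_cubeIndices_mul_le (M n : ℕ) (f : (Fin d → ℕ) → ENNReal) :
    ∑ i ∈ cubeIndices d (M * n), f i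
      ≤ ∑ b ∈ Fintype.piFinset fun _ : Fin d => Finset.range M,
        ∑ i ∈ cubeIndices d n, f fun r => i r + b r * n := by
  classical
  rw [← Finset.sum_product']
  set e : (Fin d → ℕ) → (Fin d → ℕ) × (Fin d → ℕ) :=
    fun i => (fun r => (i r - 1) / n, fun r => (i r - 1) % n + 1) with he
  have hrec : ∀ i ∈ cubeIndices d (M * n), (fun r => (e i).2 r + (e i).1 r * n) = i := by
    intro i hi
    funext r
    have h1 := (Finset.mem_Icc.1 (Fintype.mem_piFinset.1 hi r)).1
    have := Nat.mod_add_div' (i r - 1) n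
    simp only [he]
    omega
  have hmaps : ∀ i ∈ cubeIndices d (M * n), e i ∈
      (Fintype.piFinset fun _ : Fin d => Finset.range M) ×ˢ cubeIndices d n := by
    intro i hi
    refine Finset.mem_product.2 ⟨Fintype.mem_piFinset.2 fun r => ?_,
      Fintype.mem_piFinset.2 fun r => ?_⟩
    all_goals
      obtain ⟨h1, h2⟩ := Finset.mem_Icc.1 (Fintype.mem_piFinset.1 hi r)
      have hn : 0 < n := Nat.pos_of_ne_zero fun h => by simp [h] at h2; omega
    · refine Finset.mem_range.2 ((Nat.div_lt_iff_lt_mul hn).2 (by omega))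
    · refine Finset.mem_Icc.2 ⟨by simp [he], ?_⟩
      have := Nat.mod_lt (i r - 1) hn
      simp only [he]
      omega
  have hinj : Set.InjOn e (cubeIndices d (M * n)) := by
    intro i hi i' hi' h
    rw [← hrec i hi, ← hrec i' hi', h]
  calc ∑ i ∈ cubeIndices d (M * n), f i
      = ∑ i ∈ cubeIndices d (M * n), f fun r => (e i).2 r + (e i).1 r * n :=
        Finset.sum_congr rfl fun i hi => by rw [hrec i hi]
    _ = ∑ p ∈ (cubeIndices d (M * n)).image e, f fun r => p.2 r + p.1 r * n :=
        (Finset.sum_image (f := fun p : (Fin d → ℕ) × (Fin d → ℕ) =>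
          f fun r => p.2 r + p.1 r * n) hinj).symm
    _ ≤ _ := Finset.sum_le_sum_of_subset (Finset.image_subset_iff.2 hmaps)

/-- Tail comparison of decoupled U-statistics of sizes `M n` and `n`. -/
theorem decoupledLaw_sum_mul_le {F : (Fin d → E) → ENNReal} (hF : Measurable F) (M n : ℕ)
    (t : ENNReal) :
    decoupledLaw μ d {y | M ^ d * t < ∑ i ∈ cubeIndices d (M * n), F (evalTuple i y)}
      ≤ M ^ d * decoupledLaw μ d {y | t < ∑ i ∈ cubeIndices d n, F (evalTuple i y)} := by
  set Bs := Fintype.piFinset fun _ : Fin d => Finset.range M with hBs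
  have hcard : Bs.card = M ^ d := by simp [hBs, Fintype.card_piFinset]
  -- By pigeonhole one of the `M ^ d` translated cubes carries a sum above `t`; translation leaves
  -- the law unchanged.
  have hsub : {y : Fin d → ℕ → E | M ^ d * t < ∑ i ∈ cubeIndices d (M * n), F (evalTuple i y)}
      ⊆ ⋃ b ∈ Bs, {y | t < ∑ i ∈ cubeIndices d n, F (evalTuple (fun r => i r + b r * n) y)} := by
    intro y hy
    by_contra hcon
    simp only [Set.mem_iUnion, Set.mem_ofPred_eq, not_exists, not_lt] at hcon
    refine absurd (lt_of_lt_of_le hy (sum_cubeIndices_mul_le M n fun i => F (evalTuple i y)))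
      (not_lt.2 ?_)
    refine (Finset.sum_le_card_nsmul _ _ t fun b hb => hcon b hb).trans ?_
    rw [hcard, nsmul_eq_mul]
    push_cast
    exact le_rfl
  have heq : ∀ b : Fin d → ℕ, decoupledLaw μ d
      {y | t < ∑ i ∈ cubeIndices d n, F (evalTuple (fun r => i r + b r * n) y)}
      = decoupledLaw μ d {y | t < ∑ i ∈ cubeIndices d n, F (evalTuple i y)} := by
    intro b
    conv_rhs => rw [← decoupledLaw_map_reindex (μ := μ) (f := fun r j => j + b r * n)
      fun r => add_left_injective _]
    rw [Measure.map_apply (by fun_prop) (measurableSet_lt measurable_const (by fun_prop))]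
    rfl
  calc _ ≤ _ := measure_mono hsub
    _ ≤ ∑ b ∈ Bs, _ := measure_biUnion_finset_le _ _
    _ = _ := by
      rw [Finset.sum_congr rfl fun b _ => heq b, Finset.sum_const, hcard, nsmul_eq_mul]
      push_cast
      rfl

variable {Y : ℕ → Ω → E} {η : ℕ → Ω → ℝ}

/-- Tail comparison of a decoupled U-statistic with an undecoupled one of larger size. -/
theorem IsSymmetrizedSample.decoupledLaw_sum_le (hY : IsSymmetrizedSample P μ Y η)
    {F : (Fin d → E) → ENNReal} (hF : Measurable F) {n N : ℕ} (hN : d * (n + 1) ≤ N)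
    (t : ENNReal) :
    decoupledLaw μ d {y | t < ∑ i ∈ cubeIndices d n, F (evalTuple i y)}
      ≤ P {ω | t < ∑ i ∈ simplexIndices d N, F fun r => Y (i r) ω} := by
  classical
  -- For `j ≤ n` this is `j + (n + 1) r`, so sequence `r` occupies block `r` and `r ↦ f (r, i r)` is
  -- increasing for `i` in the cube. Quotients and remainders serve to extend it injectively to all
  -- `j`.
  set f : Fin d × ℕ → ℕ := fun p => p.2 % (n + 1) + (n + 1) * (p.1 + d * (p.2 / (n + 1))) with hf
  have hinj : Function.Injective f := by
    rintro ⟨r, j⟩ ⟨r', j'⟩ h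
    simp only [hf] at h
    have hn : 0 < n + 1 := n.succ_pos
    have hd : 0 < d := r.pos
    have h1 := congrArg (· % (n + 1)) h
    have h2 := congrArg (· / (n + 1)) h
    simp only [Nat.add_mul_mod_self_left, Nat.mod_mod, Nat.add_mul_div_left _ _ hn,
      Nat.div_eq_of_lt (Nat.mod_lt _ hn), zero_add] at h1 h2
    have h3 := congrArg (· % d) h2
    have h4 := congrArg (· / d) h2
    simp only [Nat.add_mul_mod_self_left, Nat.mod_eq_of_lt r.2, Nat.mod_eq_of_lt r'.2,
      Nat.add_mul_div_left _ _ hd, Nat.div_eq_of_lt r.2, Nat.div_eq_of_lt r'.2, zero_add] at h3 h4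
    have h5 : j = j' := by
      rw [← Nat.mod_add_div j (n + 1), ← Nat.mod_add_div j' (n + 1), h1, h4]
    rw [h5, Fin.ext h3]
  have hfval : ∀ i ∈ cubeIndices d n, ∀ r, f (r, i r) = i r + (n + 1) * r := by
    intro i hi r
    have h2 := (Finset.mem_Icc.1 (Fintype.mem_piFinset.1 hi r)).2
    have h3 : i r < n + 1 := by omega
    simp [hf, Nat.mod_eq_of_lt h3, Nat.div_eq_of_lt h3]
  rw [← hY.map_decoupled hinj, Measure.map_apply
    (measurable_pi_lambda _ fun r => measurable_pi_lambda _ fun j => hY.measurable_X _)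
    (measurableSet_lt measurable_const (by fun_prop))]
  refine measure_mono fun ω hω => lt_of_lt_of_le (show t < _ from hω) ?_
  have hmap : Set.InjOn (fun (i : Fin d → ℕ) r => f (r, i r)) (cubeIndices d n) := by
    intro i _ i' _ h
    funext r
    exact congrArg Prod.snd (hinj (congrFun h r))
  calc ∑ i ∈ cubeIndices d n, F (evalTuple i fun r j => Y (f (r, j)) ω)
      = ∑ i ∈ (cubeIndices d n).image fun i r => f (r, i r), F fun r => Y (i r) ω :=
        (Finset.sum_image (f := fun i : Fin d → ℕ => F fun r => Y (i r) ω) hmap).symm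
    _ ≤ _ := by
        refine Finset.sum_le_sum_of_subset (Finset.image_subset_iff.2 fun i hi => ?_)
        refine Finset.mem_filter.2 ⟨Fintype.mem_piFinset.2 fun r => ?_, fun r r' hrr' => ?_⟩
        · rw [hfval i hi]
          obtain ⟨h1, h2⟩ := Finset.mem_Icc.1 (Fintype.mem_piFinset.1 hi r)
          refine Finset.mem_Icc.2 ⟨by omega, le_trans ?_ hN⟩
          have h3 : (r : ℕ) + 1 ≤ d := r.2
          calc i r + (n + 1) * r ≤ (n + 1) * (r + 1) := by
                rw [mul_add, mul_one]
                omega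
            _ ≤ (n + 1) * d := Nat.mul_le_mul_left _ h3
            _ = d * (n + 1) := mul_comm _ _
        · simp only [hfval i hi]
          have h1 := (Finset.mem_Icc.1 (Fintype.mem_piFinset.1 hi r)).2
          have h3 : (r : ℕ) + 1 ≤ r' := hrr'
          calc i r + (n + 1) * r < (n + 1) * (r + 1) := by
                rw [mul_add, mul_one]
                omega
            _ ≤ (n + 1) * r' := Nat.mul_le_mul_left _ h3
            _ ≤ _ := Nat.le_add_left _ _

/-- The colors of the `d` distinct points `i r` are prescribed and the other `N - d` are free;
multiplying by `d ^ d` avoids the subtraction in the exponent. -/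
theorem pow_mul_card_coloring {N : ℕ} {i : Fin d → Fin N} (hi : Function.Injective i) :
    d ^ d * (Finset.univ.filter fun c : Fin N → Fin d => ∀ r, c (i r) = r).card = d ^ N := by
  classical
  set t : Fin N → Finset (Fin d) := fun j => Finset.univ.filter fun s => ∀ r, i r = j → s = r
    with ht
  have h1 : (Finset.univ.filter fun c : Fin N → Fin d => ∀ r, c (i r) = r)
      = Fintype.piFinset t := by
    ext c
    simp only [Finset.mem_filter, Finset.mem_univ, true_and, Fintype.mem_piFinset, ht]
    exact ⟨fun h j r hr => hr ▸ h r, fun h r => h _ r rfl⟩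
  have h2 : ∀ j, (t j).card = if j ∈ Finset.univ.image i then 1 else d := by
    intro j
    split_ifs with h
    · obtain ⟨r, -, rfl⟩ := Finset.mem_image.1 h
      refine Finset.card_eq_one.2 ⟨r, ?_⟩
      ext s
      simp only [ht, Finset.mem_filter, Finset.mem_univ, true_and, Finset.mem_singleton]
      exact ⟨fun h => h r rfl, fun h r' hr' => by rw [h, hi hr']⟩
    · have : t j = Finset.univ := by
        ext s
        simp only [ht, Finset.mem_filter, Finset.mem_univ, true_and, iff_true]
        exact fun r hr => absurd (Finset.mem_image.2 ⟨r, Finset.mem_univ _, hr⟩) h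
      rw [this, Finset.card_univ, Fintype.card_fin]
  have h3 : (Finset.univ.filter fun j => j ∈ Finset.univ.image i).card = d := by
    rw [Finset.filter_mem_eq_inter, Finset.univ_inter, Finset.card_image_of_injective _ hi,
      Finset.card_univ, Fintype.card_fin]
  have h4 := Finset.card_filter_add_card_filter_not (s := (Finset.univ : Finset (Fin N)))
    (fun j => j ∈ Finset.univ.image i)
  rw [h3, Finset.card_univ, Fintype.card_fin] at h4
  rw [h1, Fintype.card_piFinset, Finset.prod_congr rfl fun j _ => h2 j, Finset.prod_ite,
    Finset.prod_const_one, one_mul, Finset.prod_const, ← pow_add, h4]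

/-- Decoupling by random colorings: an undecoupled sample visits `B` with probability at most
`d ^ d` times that of a decoupled sample. -/
theorem IsSymmetrizedSample.measure_exists_mem_le (hY : IsSymmetrizedSample P μ Y η)
    (hd : 1 ≤ d) {B : Set (Fin d → E)} (hB : MeasurableSet B) (N : ℕ) :
    P {ω | ∃ i ∈ simplexIndices d N, (fun r => Y (i r) ω) ∈ B}
      ≤ d ^ d * decoupledLaw μ d {y | ∃ i ∈ cubeIndices d N, evalTuple i y ∈ B} := by
  classical
  set p := decoupledLaw μ d {y | ∃ i ∈ cubeIndices d N, evalTuple i y ∈ B} with hp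
  -- Positions `0, …, N` are colored although only `1, …, N` occur in multi-indices, hence the
  -- exponent `N + 1`. Beyond `N` the default color plays no role.
  set col : (Fin (N + 1) → Fin d) → ℕ → Fin d :=
    fun c j => if h : j < N + 1 then c ⟨j, h⟩ else ⟨0, hd⟩ with hcol
  set S : (Fin (N + 1) → Fin d) → Set (ℕ → E) := fun c =>
    ⋃ i ∈ simplexIndices d N, {x | (∀ r, col c (i r) = r) ∧ (fun r => x (i r)) ∈ B} with hS
  have hSm : ∀ c, MeasurableSet (S c) := by
    intro c
    refine Finset.measurableSet_biUnion _ fun i _ => ?_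
    refine MeasurableSet.inter (MeasurableSet.const _) ?_
    exact (measurable_pi_lambda _ fun r => measurable_pi_apply (i r)) hB
  -- If the sequence is built by reading color `c j` at time `j`, a correctly colored multi-index
  -- reads its `r`-th entry from sequence `r`, so its point is one of the decoupled sample.
  have hSp : ∀ c, seqLaw μ (S c) ≤ p := by
    intro c
    rw [← decoupledLaw_map_diagonal (μ := μ) (col c), Measure.map_apply (by fun_prop) (hSm c)]
    refine measure_mono fun y hy => ?_
    obtain ⟨i, hi, h1, h2⟩ : ∃ i ∈ simplexIndices d N, (∀ r, col c (i r) = r) ∧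
        (fun r => y (col c (i r)) (i r)) ∈ B := by
      simpa only [hS, Set.mem_preimage, Set.mem_iUnion, exists_prop, Set.mem_ofPred_eq] using hy
    refine ⟨i, (Finset.mem_filter.1 hi).1, ?_⟩
    simp only [h1] at h2
    exact h2
  set D : Set (ℕ → E) := ⋃ i ∈ simplexIndices d N, {x | (fun r => x (i r)) ∈ B} with hD
  have hDm : MeasurableSet D := Finset.measurableSet_biUnion _ fun i _ =>
    (measurable_pi_lambda _ fun r => measurable_pi_apply (i r)) hB
  have hPD : P {ω | ∃ i ∈ simplexIndices d N, (fun r => Y (i r) ω) ∈ B} = seqLaw μ D := by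
    have hlaw : P.map (fun ω j => Y j ω) = seqLaw μ :=
      hY.map_comp_injective (f := id) Function.injective_id
    rw [← hlaw, Measure.map_apply (measurable_pi_lambda _ fun k => hY.measurable_X k) hDm]
    congr 1
    ext ω
    simp [hD]
  rw [hPD]
  -- Averaging over colorings: a visiting multi-index is correctly colored by a fraction `d ^ (-d)`
  -- of them.
  have hpt : ∀ x, (d ^ (N + 1) : ENNReal) * D.indicator 1 x
      ≤ d ^ d * ∑ c, (S c).indicator 1 x := by
    intro x
    by_cases hx : x ∈ D
    swap
    · simp [Set.indicator_of_notMem hx]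
    obtain ⟨i, hi, hxi⟩ : ∃ i ∈ simplexIndices d N, (fun r => x (i r)) ∈ B := by
      simpa [hD] using hx
    obtain ⟨hi1, hi2⟩ := Finset.mem_filter.1 hi
    have hlt : ∀ r, i r < N + 1 := fun r =>
      Nat.lt_succ_of_le (Finset.mem_Icc.1 (Fintype.mem_piFinset.1 hi1 r)).2
    have hcard := pow_mul_card_coloring (i := fun r => (⟨i r, hlt r⟩ : Fin (N + 1)))
      fun r r' h => hi2.injective (by simpa using h)
    rw [Set.indicator_of_mem hx, Pi.one_apply, mul_one]
    calc (d ^ (N + 1) : ENNReal) = d ^ d * ((Finset.univ.filter fun c : Fin (N + 1) → Fin d =>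
            ∀ r, c ⟨i r, hlt r⟩ = r).card : ENNReal) := by exact_mod_cast hcard.symm
      _ = d ^ d * ∑ c ∈ Finset.univ.filter fun c : Fin (N + 1) → Fin d =>
            ∀ r, c ⟨i r, hlt r⟩ = r, 1 := by simp
      _ ≤ d ^ d * ∑ c ∈ Finset.univ.filter fun c : Fin (N + 1) → Fin d =>
            ∀ r, c ⟨i r, hlt r⟩ = r, (S c).indicator 1 x := by
          gcongr with c hc
          rw [Set.indicator_of_mem, Pi.one_apply]
          have hc' := (Finset.mem_filter.1 hc).2
          refine Set.mem_biUnion hi ⟨fun r => ?_, hxi⟩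
          simp only [hcol, hlt r, dif_pos, hc' r]
      _ ≤ _ := by
          gcongr
          exact Finset.filter_subset _ _
  have hmain : (d ^ (N + 1) : ENNReal) * seqLaw μ D ≤ d ^ (N + 1) * (d ^ d * p) := by
    calc (d ^ (N + 1) : ENNReal) * seqLaw μ D
        = ∫⁻ x, (d ^ (N + 1) : ENNReal) * D.indicator 1 x ∂seqLaw μ := by
          rw [lintegral_const_mul _ (measurable_one.indicator hDm), lintegral_indicator_one hDm]
      _ ≤ ∫⁻ x, d ^ d * ∑ c, (S c).indicator 1 x ∂seqLaw μ := lintegral_mono hpt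
      _ = d ^ d * ∑ c, seqLaw μ (S c) := by
          have hm : ∀ c, Measurable fun x => (S c).indicator (1 : (ℕ → E) → ENNReal) x :=
            fun c => measurable_one.indicator (hSm c)
          rw [lintegral_const_mul _ (Finset.measurable_fun_sum _ fun c _ => hm c),
            lintegral_finsetSum _ fun c _ => hm c]
          simp_rw [lintegral_indicator_one (hSm _)]
      _ ≤ d ^ d * ∑ _c : Fin (N + 1) → Fin d, p := by
          gcongr with c
          exact hSp c
      _ = _ := by
          rw [Finset.sum_const, nsmul_eq_mul, Finset.card_univ, Fintype.card_fun,
            Fintype.card_fin, Fintype.card_fin]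
          push_cast
          ring
  have hd0 : (d : ENNReal) ≠ 0 := by
    exact_mod_cast (show d ≠ 0 by omega)
  exact (ENNReal.mul_le_mul_iff_right (pow_ne_zero _ hd0) (by finiteness)).1 hmain

end Laws

/-! ### Symmetry of the signs and their independence from the sample -/

section SampleSigns

variable {Ω E ι : Type*} [MeasurableSpace Ω] [MeasurableSpace E]
  {P : Measure Ω} {μ : Measure E} {X : ι → Ω → E} {ε : ι → Ω → ℝ}

theorem IsSymmetrizedSample.measurable_pair (hX : IsSymmetrizedSample P μ X ε) :
    Measurable fun ω => (fun j => X j ω, fun j => ε j ω) :=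
  (measurable_pi_lambda _ hX.measurable_X).prodMk (measurable_pi_lambda _ hX.measurable_ε)

variable [IsProbabilityMeasure P]

theorem ae_eq_one_or_of_measure_eq_half {Y : Ω → ℝ} (hY : Measurable Y)
    (h1 : P {ω | Y ω = 1} = 1 / 2) (h2 : P {ω | Y ω = -1} = 1 / 2) :
    ∀ᵐ ω ∂P, Y ω = 1 ∨ Y ω = -1 := by
  have hm1 : MeasurableSet {ω | Y ω = 1} := hY (measurableSet_singleton 1)
  have hm2 : MeasurableSet {ω | Y ω = -1} := hY (measurableSet_singleton (-1))
  have hdisj : Disjoint {ω | Y ω = 1} {ω | Y ω = -1} := by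
    rw [Set.disjoint_left]
    intro ω ha hb
    rw [Set.mem_ofPred_eq] at ha hb
    rw [ha] at hb
    norm_num at hb
  have hu : P ({ω | Y ω = 1} ∪ {ω | Y ω = -1}) = 1 := by
    rw [measure_union hdisj hm2, h1, h2, ENNReal.add_halves]
  exact (prob_compl_eq_zero_iff (hm1.union hm2)).2 hu

theorem map_neg_eq_map_of_measure_eq_half {Y : Ω → ℝ} (hY : Measurable Y)
    (h1 : P {ω | Y ω = 1} = 1 / 2) (h2 : P {ω | Y ω = -1} = 1 / 2) :
    P.map (fun ω => -Y ω) = P.map Y := by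
  have key : ∀ Z : Ω → ℝ, Measurable Z → P {ω | Z ω = 1} = 1 / 2 → P {ω | Z ω = -1} = 1 / 2 →
      P.map Z = (1 / 2 : ENNReal) • Measure.dirac 1 + (1 / 2 : ENNReal) • Measure.dirac (-1) := by
    intro Z hZ h1 h2
    have hae := ae_eq_one_or_of_measure_eq_half hZ h1 h2
    ext s hs
    rw [Measure.map_apply hZ hs]
    have hm1 : MeasurableSet {ω | Z ω = 1} := hZ (measurableSet_singleton 1)
    rw [← measure_inter_add_sdiff _ hm1]
    have e1 : P (Z ⁻¹' s ∩ {ω | Z ω = 1}) = 1 / 2 * s.indicator 1 1 := by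
      by_cases h : (1 : ℝ) ∈ s
      · have : Z ⁻¹' s ∩ {ω | Z ω = 1} = {ω | Z ω = 1} := by
          refine Set.inter_eq_right.2 fun ω hω => ?_
          rw [Set.mem_ofPred_eq] at hω
          rwa [Set.mem_preimage, hω]
        simp [this, h1, h]
      · have : Z ⁻¹' s ∩ {ω | Z ω = 1} = ∅ := by
          refine Set.eq_empty_of_forall_notMem fun ω hω => h ?_
          have h2 : Z ω = 1 := hω.2
          exact h2 ▸ hω.1
        simp [this, h]
    have e2 : P (Z ⁻¹' s \ {ω | Z ω = 1}) = 1 / 2 * s.indicator 1 (-1) := by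
      have hcongr : P (Z ⁻¹' s \ {ω | Z ω = 1}) = P (Z ⁻¹' s ∩ {ω | Z ω = -1}) := by
        refine measure_congr ?_
        filter_upwards [hae] with ω hω
        refine propext (and_congr_right fun _ => ?_)
        change ¬ (Z ω = 1) ↔ Z ω = -1
        rcases hω with h | h <;> rw [h] <;> norm_num
      rw [hcongr]
      by_cases h : (-1 : ℝ) ∈ s
      · have : Z ⁻¹' s ∩ {ω | Z ω = -1} = {ω | Z ω = -1} := by
          refine Set.inter_eq_right.2 fun ω hω => ?_
          rw [Set.mem_ofPred_eq] at hω
          rwa [Set.mem_preimage, hω]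
        simp [this, h2, h]
      · have : Z ⁻¹' s ∩ {ω | Z ω = -1} = ∅ := by
          refine Set.eq_empty_of_forall_notMem fun ω hω => h ?_
          have h2 : Z ω = -1 := hω.2
          exact h2 ▸ hω.1
        simp [this, h]
    rw [e1, e2]
    simp [Measure.dirac_apply' _ hs]
  rw [key Y hY h1 h2, key _ hY.fun_neg (by simpa [neg_eq_iff_eq_neg] using h2)
    (by simpa [neg_eq_iff_eq_neg] using h1)]

/-- Flipping one coordinate of an independent family of symmetric signs leaves all one-dimensional
laws unchanged, hence also the product law. -/
theorem IsSymmetrizedSample.isSignMeasure (hX : IsSymmetrizedSample P μ X ε) :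
    IsSignMeasure (P.map fun ω p => ε p ω) := by
  classical
  have hmeas : Measurable fun ω p => ε p ω := measurable_pi_lambda _ hX.measurable_ε
  refine ⟨fun p => ?_, fun p => ?_⟩
  · rw [ae_map_iff hmeas.aemeasurable]
    · exact ae_eq_one_or_of_measure_eq_half (hX.measurable_ε p) (hX.prob_one p)
        (hX.prob_neg_one p)
    · exact (measurable_pi_apply p (measurableSet_singleton 1)).union
        (measurable_pi_apply p (measurableSet_singleton (-1)))
  · set g : ι → ℝ → ℝ := fun q x => if q = p then -x else x with hg
    have hgm : ∀ q, Measurable (g q) := by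
      intro q
      by_cases h : q = p
      · simpa only [hg, h, if_true] using measurable_neg
      · simpa only [hg, h, if_false] using measurable_id'
    have hlaw : ∀ q, P.map (g q ∘ ε q) = P.map (ε q) := by
      intro q
      by_cases h : q = p
      · have : g q ∘ ε q = fun ω => -ε q ω := by
          funext ω
          simp [hg, h]
        rw [this]
        exact map_neg_eq_map_of_measure_eq_half (hX.measurable_ε q) (hX.prob_one q)
          (hX.prob_neg_one q)
      · have : g q ∘ ε q = ε q := by
          funext ω
          simp [hg, h]
        rw [this]
    have hflip : (flipSign p ∘ fun ω q => ε q ω) = fun ω q => (g q ∘ ε q) ω := by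
      funext ω q
      by_cases h : q = p
      · subst h
        simp [hg]
      · simp [hg, h, flipSign_of_ne h]
    rw [Measure.map_map (measurable_flipSign p) hmeas, hflip,
      (hX.indep_ε.comp g hgm).map_fun_eq_infinitePi_map
        fun q => (hgm q).comp (hX.measurable_ε q),
      hX.indep_ε.map_fun_eq_infinitePi_map hX.measurable_ε]
    exact congrArg _ (funext hlaw)

theorem IsSymmetrizedSample.map_prod (hX : IsSymmetrizedSample P μ X ε) :
    P.map (fun ω => (fun j => X j ω, fun j => ε j ω))
      = (P.map fun ω j => X j ω).prod (P.map fun ω j => ε j ω) :=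
  (indepFun_iff_map_prod_eq_prod_map_map
    (measurable_pi_lambda _ hX.measurable_X).aemeasurable
    (measurable_pi_lambda _ hX.measurable_ε).aemeasurable).1 hX.indep_X_ε

end SampleSigns

/-! ### Independence of dyadic blocks -/

section Blocks

variable {Ω E ι : Type*} [MeasurableSpace Ω] [MeasurableSpace E]
  {P : Measure Ω} [IsProbabilityMeasure P] {μ : Measure E} [IsProbabilityMeasure μ]
  {X : ι → Ω → E} {ε : ι → Ω → ℝ}

/-- The indices of level in the dyadic block `(2^k, 2^{k+1}]`. -/
abbrev DyadicBlock (lev : ι → ℕ) (k : ℕ) : Type _ := {p : ι // 2 ^ k < lev p ∧ lev p ≤ 2 ^ (k + 1)}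

/-- The intervals `(2 ^ k, 2 ^ (k + 1)]` are disjoint, so the blocks together form an i.i.d. family;
currying its product law gives independence of the blocks. -/
theorem IsSymmetrizedSample.iIndepFun_blocks (hX : IsSymmetrizedSample P μ X ε) (lev : ι → ℕ) :
    iIndepFun (fun k ω (p : DyadicBlock lev k) => X p ω) P := by
  have hmX : ∀ k, Measurable fun ω (p : DyadicBlock lev k) => X p ω :=
    fun k => measurable_pi_lambda _ fun p => hX.measurable_X _
  rw [iIndepFun_iff_map_fun_eq_infinitePi_map hmX]
  have hinj : Function.Injective fun s : Σ k, DyadicBlock lev k => (s.2 : ι) := by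
    have hk : ∀ {k k' : ℕ} {p : ι}, 2 ^ k < lev p → lev p ≤ 2 ^ (k' + 1) → k ≤ k' := by
      intro k k' p h1 h2
      have := (Nat.pow_lt_pow_iff_right (by norm_num : 1 < 2)).1 (h1.trans_le h2)
      omega
    rintro ⟨k, p, h1, h2⟩ ⟨k', p', h1', h2'⟩ h
    simp only at h
    subst h
    obtain rfl := le_antisymm (hk h1 h2') (hk h1' h2)
    rfl
  have h1 := hX.map_comp_injective hinj
  have h2 := Measure.infinitePi_map_piCurry (X := fun (k : ℕ) (_ : DyadicBlock lev k) => E)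
    (fun _ _ => μ)
  rw [← h1, Measure.map_map (MeasurableEquiv.measurable _)
    (measurable_pi_lambda _ fun k => hX.measurable_X _)] at h2
  refine h2.trans (congrArg _ (funext fun k => ?_))
  exact (hX.map_comp_injective (f := fun p : DyadicBlock lev k => (p : ι))
    Subtype.val_injective).symm

/-- Second Borel–Cantelli lemma for events determined by disjoint dyadic blocks. -/
theorem IsSymmetrizedSample.tsum_blocks_lt_top (hX : IsSymmetrizedSample P μ X ε) (lev : ι → ℕ)
    {M : ∀ k, Set (DyadicBlock lev k → E)} (hM : ∀ k, MeasurableSet (M k))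
    (hev : ∀ᵐ ω ∂P, ∀ᶠ k in atTop, (fun p : DyadicBlock lev k => X p ω) ∉ M k) :
    ∑' k, P {ω | (fun p : DyadicBlock lev k => X p ω) ∈ M k} < ⊤ := by
  have hmX : ∀ k, Measurable fun ω (p : DyadicBlock lev k) => X p ω :=
    fun k => measurable_pi_lambda _ fun p => hX.measurable_X _
  set B : ℕ → Set Ω := fun k => {ω | (fun p : DyadicBlock lev k => X p ω) ∈ M k} with hB
  have hBm : ∀ k, MeasurableSet (B k) := fun k => hmX k (hM k)
  have hind : iIndepSet B P := by
    rw [iIndepSet_iff_meas_biInter hBm]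
    intro s
    exact (hX.iIndepFun_blocks lev).measure_inter_preimage_eq_mul s fun k _ => hM k
  by_contra hcon
  have h1 := measure_limsup_eq_one hBm hind (not_lt_top_iff.1 hcon)
  have h0 : P (limsup B atTop) = 0 := by
    rw [measure_eq_zero_iff_ae_notMem]
    filter_upwards [hev] with ω hω
    rw [mem_limsup_iff_frequently_mem, not_frequently]
    exact hω
  rw [h0] at h1
  exact zero_ne_one h1

end Blocks

/-! ### Limit theorems common to the cube and the simplex -/

section Indexing

/-- The properties of the index sets shared by the decoupled and the undecoupled sums. -/
structure IsShiftIndexing {ι : Type*} {d : ℕ} (idx : (Fin d → ℕ) → Fin d → ι)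
    (T : ℕ → Finset (Fin d → ℕ)) (lev : ι → ℕ) (shift : ℕ → ι → ι) : Prop
    extends IsAdaptedIndexing idx T lev where
  card_le : ∀ n, (T n).card ≤ n ^ d
  one_le_lev : ∀ n, ∀ i ∈ T n, ∀ r, 1 ≤ lev (idx i r)
  shift_injective : ∀ n, Function.Injective (shift n)
  lev_shift : ∀ n p, lev (shift n p) = lev p + n
  shift_mem : ∀ n, ∀ i ∈ T n, (fun r => i r + n) ∈ T (2 * n)
  idx_shift : ∀ n i r, idx (fun r => i r + n) r = shift n (idx i r)

variable {Ω E ι : Type*} [MeasurableSpace Ω] [MeasurableSpace E]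
  {P : Measure Ω} [IsProbabilityMeasure P] {μ : Measure E}
  {X : ι → Ω → E} {ε : ι → Ω → ℝ} {d : ℕ} {idx : (Fin d → ℕ) → Fin d → ι}
  {T : ℕ → Finset (Fin d → ℕ)} {lev : ι → ℕ} {shift : ℕ → ι → ι}

theorem measurable_chaosSum_pair {f : (Fin d → E) → ℝ} (hf : Measurable f)
    (idx : (Fin d → ℕ) → Fin d → ι) (T : Finset (Fin d → ℕ)) (a : ℝ) :
    Measurable fun z : (ι → E) × (ι → ℝ) =>
      chaosSum idx T (fun i => a * f fun r => z.1 (idx i r)) z.2 := by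
  unfold chaosSum
  fun_prop

/-- Almost sure convergence of the randomized sums implies that of the sums of squares. -/
theorem IsSymmetrizedSample.ae_tendsto_sq (hX : IsSymmetrizedSample P μ X ε)
    (hT : ∀ n, IsTetrahedral idx (T n)) {h : (Fin d → E) → ℝ} (hh : Measurable h) (γ : ℕ → ℝ)
    (hlim : ∀ᵐ ω ∂P, Tendsto (fun n : ℕ => 1 / γ n *
      ∑ i ∈ T n, (∏ r, ε (idx i r) ω) * h (fun r => X (idx i r) ω)) atTop (𝓝 0)) :
    ∀ᵐ ω ∂P, Tendsto (fun n : ℕ => 1 / γ n ^ 2 *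
      ∑ i ∈ T n, h (fun r => X (idx i r) ω) ^ 2) atTop (𝓝 0) := by
  have hXm : Measurable fun ω j => X j ω := measurable_pi_lambda _ hX.measurable_X
  have hεm : Measurable fun ω j => ε j ω := measurable_pi_lambda _ hX.measurable_ε
  have : IsProbabilityMeasure (P.map fun ω j => X j ω) :=
    Measure.isProbabilityMeasure_map hXm.aemeasurable
  have : IsProbabilityMeasure (P.map fun ω j => ε j ω) :=
    Measure.isProbabilityMeasure_map hεm.aemeasurable
  have hset : MeasurableSet {z : (ι → E) × (ι → ℝ) | Tendsto (fun n => chaosSum idx (T n)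
      (fun i => 1 / γ n * h fun r => z.1 (idx i r)) z.2) atTop (𝓝 0)} :=
    measurableSet_tendsto _ fun n => measurable_chaosSum_pair hh idx (T n) (1 / γ n)
  have hz : ∀ᵐ z ∂(P.map fun ω j => X j ω).prod (P.map fun ω j => ε j ω),
      Tendsto (fun n => chaosSum idx (T n)
        (fun i => 1 / γ n * h fun r => z.1 (idx i r)) z.2) atTop (𝓝 0) := by
    rw [← hX.map_prod, ae_map_iff hX.measurable_pair.aemeasurable hset]
    filter_upwards [hlim] with ω hω
    refine hω.congr fun n => ?_
    rw [chaosSum, Finset.mul_sum]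
    refine Finset.sum_congr rfl fun i _ => ?_
    ring
  refine ae_of_ae_map (p := fun x : ι → E => Tendsto (fun n : ℕ => 1 / γ n ^ 2 *
    ∑ i ∈ T n, h (fun r => x (idx i r)) ^ 2) atTop (𝓝 0)) hXm.aemeasurable ?_
  -- By Fubini, for almost every fixed sample the chaos in the signs converges almost surely, and
  -- the deterministic statement on coefficients applies.
  filter_upwards [Measure.ae_ae_of_ae_prod hz] with x hx
  refine (tendsto_sum_sq_of_ae_tendsto_chaosSum hX.isSignMeasure hT _ hx).congr fun n => ?_
  rw [Finset.mul_sum]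
  refine Finset.sum_congr rfl fun i _ => ?_
  rw [mul_pow, one_div_pow]

variable [IsProbabilityMeasure μ]

/-- Maximal inequality for randomized U-statistics. -/
theorem IsSymmetrizedSample.maximal_le (hX : IsSymmetrizedSample P μ X ε)
    (hT : IsAdaptedIndexing idx T lev) {f : (Fin d → E) → ℝ} (hf : Measurable f) (N : ℕ) {t : ℝ}
    (ht : 0 ≤ t) :
    ENNReal.ofReal (t ^ 2) * P {ω | ∃ n ≤ N, t ≤
        |∑ i ∈ T n, (∏ r, ε (idx i r) ω) * f (fun r => X (idx i r) ω)|}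
      ≤ (T N).card * ∫⁻ x, ENNReal.ofReal (f x ^ 2) ∂(Measure.pi fun _ => μ) := by
  have hXm : Measurable fun ω j => X j ω := measurable_pi_lambda _ hX.measurable_X
  have hεm : Measurable fun ω j => ε j ω := measurable_pi_lambda _ hX.measurable_ε
  have : IsProbabilityMeasure (P.map fun ω j => X j ω) :=
    Measure.isProbabilityMeasure_map hXm.aemeasurable
  have : IsProbabilityMeasure (P.map fun ω j => ε j ω) :=
    Measure.isProbabilityMeasure_map hεm.aemeasurable
  set S : Set ((ι → E) × (ι → ℝ)) := {z | ∃ n ≤ N, t ≤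
    |chaosSum idx (T n) (fun i => f fun r => z.1 (idx i r)) z.2|} with hS
  have hSm : MeasurableSet S := by
    have : S = ⋃ n ∈ Finset.range (N + 1), {z | t ≤
        |chaosSum idx (T n) (fun i => f fun r => z.1 (idx i r)) z.2|} := by
      ext z
      simp [hS]
    rw [this]
    refine Finset.measurableSet_biUnion _ fun n _ => measurableSet_le measurable_const ?_
    have := measurable_chaosSum_pair hf idx (T n) 1
    simp only [one_mul] at this
    exact continuous_abs.measurable.comp this
  have hP : P {ω | ∃ n ≤ N, t ≤
      |∑ i ∈ T n, (∏ r, ε (idx i r) ω) * f (fun r => X (idx i r) ω)|}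
      = ∫⁻ x, (P.map fun ω j => ε j ω) (Prod.mk x ⁻¹' S) ∂(P.map fun ω j => X j ω) := by
    rw [← Measure.prod_apply hSm, ← hX.map_prod, Measure.map_apply hX.measurable_pair hSm]
    rfl
  have hfm : ∀ i, Measurable fun x : ι → E => ENNReal.ofReal (f (fun r => x (idx i r)) ^ 2) := by
    intro i
    fun_prop
  rw [hP, ← lintegral_const_mul _ (measurable_measure_prodMk_left hSm)]
  calc _ ≤ ∫⁻ x, ∑ i ∈ T N, ENNReal.ofReal (f (fun r => x (idx i r)) ^ 2)
        ∂(P.map fun ω j => X j ω) := by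
        refine lintegral_mono fun x => ?_
        rw [← ENNReal.ofReal_sum_of_nonneg fun i _ => sq_nonneg _]
        exact hT.maximal_le hX.isSignMeasure _ N ht
    _ = ∑ i ∈ T N, ∫⁻ x, ENNReal.ofReal (f x ^ 2) ∂(Measure.pi fun _ => μ) := by
        rw [lintegral_finsetSum _ fun i _ => hfm i]
        refine Finset.sum_congr rfl fun i hi => ?_
        have hlaw := hX.map_comp_injective ((hT.tetrahedral N).injective i hi)
        rw [Measure.infinitePi_eq_pi] at hlaw
        rw [← hlaw, lintegral_map (hfm i) hXm, lintegral_map (by fun_prop)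
          (measurable_pi_lambda _ fun k => hX.measurable_X _)]
    _ = _ := by rw [Finset.sum_const, nsmul_eq_mul]

/-- Strong law for randomized U-statistics under summability of the truncation errors and of the
truncated second moments. -/
theorem IsSymmetrizedSample.ae_tendsto_of_truncation (hX : IsSymmetrizedSample P μ X ε)
    (hT : IsShiftIndexing idx T lev shift) {γ : ℕ → ℝ} {C : ℝ}
    (hγ : IsRegularNormalizer d γ C) {h : (Fin d → E) → ℝ} (hh : Measurable h)
    {A : ℕ → Set (Fin d → E)} (hA : ∀ k, MeasurableSet (A k))
    (hout : ∑' k : ℕ, P {ω | ∃ i ∈ T (2 ^ (k + 1)), (fun r => X (idx i r) ω) ∉ A (k + 1)} < ⊤)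
    (hmom : ∑' k : ℕ, ((2 : ENNReal) ^ (k + 1)) ^ d *
      ∫⁻ x, (ENNReal.ofReal (γ (2 ^ (k + 1)) ^ 2))⁻¹ * (A (k + 1)).indicator
        (fun y => ENNReal.ofReal (h y ^ 2)) x ∂(Measure.pi fun _ => μ) < ⊤) :
    ∀ᵐ ω ∂P, Tendsto (fun n : ℕ => 1 / γ n *
      ∑ i ∈ T n, (∏ r, ε (idx i r) ω) * h (fun r => X (idx i r) ω)) atTop (𝓝 0) := by
  have hpos : ∀ k, 0 < γ (2 ^ k) := fun k => hγ.pos _ Nat.one_le_two_pow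
  have hC : 0 < C := by
    have h1 := hγ.doubling 1 le_rfl
    have h2 := hγ.pos 1 le_rfl
    have h3 := hγ.pos (2 * 1) (by norm_num)
    exact pos_of_mul_pos_left (h3.trans_le h1) h2.le
  set f : ℕ → (Fin d → E) → ℝ := fun k => (A (k + 1)).indicator h with hf
  have hfm : ∀ k, Measurable (f k) := fun k => hh.indicator (hA _)
  have hfsq : ∀ k x, ENNReal.ofReal (f k x ^ 2)
      = (A (k + 1)).indicator (fun y => ENNReal.ofReal (h y ^ 2)) x := by
    intro k x
    by_cases hx : x ∈ A (k + 1)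
    · simp [hf, hx]
    · simp [hf, hx]
  -- Thresholds `1 / (q + 1)` keep the exceptional sets countable in number. The maximum over all `n
  -- ≤ 2 ^ (k + 1)` is handled with the single kernel truncated at level `k + 1`.
  have hlarge : ∀ q : ℕ, ∀ᵐ ω ∂P, ∀ᶠ k : ℕ in atTop, ∀ n ≤ 2 ^ (k + 1),
      |∑ i ∈ T n, (∏ r, ε (idx i r) ω) * f k (fun r => X (idx i r) ω)|
        < 1 / ((q : ℝ) + 1) * γ (2 ^ (k + 1)) := by
    intro q
    set η : ℝ := 1 / ((q : ℝ) + 1) with hη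
    have hη0 : 0 < η := by positivity
    have hbound : ∀ k : ℕ, P {ω | ∃ n ≤ 2 ^ (k + 1), η * γ (2 ^ (k + 1)) ≤
        |∑ i ∈ T n, (∏ r, ε (idx i r) ω) * f k (fun r => X (idx i r) ω)|}
        ≤ (ENNReal.ofReal (η ^ 2))⁻¹ * (((2 : ENNReal) ^ (k + 1)) ^ d *
      ∫⁻ x, (ENNReal.ofReal (γ (2 ^ (k + 1)) ^ 2))⁻¹ * (A (k + 1)).indicator
        (fun y => ENNReal.ofReal (h y ^ 2)) x ∂(Measure.pi fun _ => μ)) := by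
      intro k
      have hm := hX.maximal_le hT.toIsAdaptedIndexing (hfm k) (2 ^ (k + 1))
        (t := η * γ (2 ^ (k + 1))) (mul_pos hη0 (hpos _)).le
      set p := P {ω | ∃ n ≤ 2 ^ (k + 1), η * γ (2 ^ (k + 1)) ≤
        |∑ i ∈ T n, (∏ r, ε (idx i r) ω) * f k (fun r => X (idx i r) ω)|}
      have hg0 : ENNReal.ofReal (γ (2 ^ (k + 1)) ^ 2) ≠ 0 := by simpa using (hpos _).ne'
      have he0 : ENNReal.ofReal (η ^ 2) ≠ 0 := by simpa using hη0.ne'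
      rw [mul_pow, ENNReal.ofReal_mul (sq_nonneg _)] at hm
      simp_rw [hfsq] at hm
      rw [lintegral_const_mul _ ((hh.pow_const 2).ennreal_ofReal.indicator (hA _))]
      have hcard : ((T (2 ^ (k + 1))).card : ENNReal) ≤ ((2 : ENNReal) ^ (k + 1)) ^ d := by
        exact_mod_cast hT.card_le (2 ^ (k + 1))
      set a := ENNReal.ofReal (γ (2 ^ (k + 1)) ^ 2)
      set b := ENNReal.ofReal (η ^ 2)
      calc p = b⁻¹ * a⁻¹ * (b * a * p) := by
            rw [show b⁻¹ * a⁻¹ * (b * a * p) = (b⁻¹ * b) * (a⁻¹ * a) * p by ring,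
              ENNReal.inv_mul_cancel he0 ENNReal.ofReal_ne_top,
              ENNReal.inv_mul_cancel hg0 ENNReal.ofReal_ne_top, one_mul, one_mul]
        _ ≤ b⁻¹ * a⁻¹ * (((2 : ENNReal) ^ (k + 1)) ^ d * ∫⁻ x, (A (k + 1)).indicator
              (fun y => ENNReal.ofReal (h y ^ 2)) x ∂(Measure.pi fun _ => μ)) := by
            refine mul_le_mul_right (hm.trans ?_) _
            gcongr
        _ = _ := by ring
    have hsum := ae_eventually_notMem (μ := P) (s := fun k => {ω | ∃ n ≤ 2 ^ (k + 1),
        η * γ (2 ^ (k + 1)) ≤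
        |∑ i ∈ T n, (∏ r, ε (idx i r) ω) * f k (fun r => X (idx i r) ω)|}) (by
      refine ne_top_of_le_ne_top ?_ (ENNReal.tsum_le_tsum hbound)
      rw [ENNReal.tsum_mul_left]
      refine ENNReal.mul_ne_top (ENNReal.inv_ne_top.2 (by simpa using hη0.ne')) hmom.ne)
    filter_upwards [hsum] with ω hω
    filter_upwards [hω] with k hk n hn
    by_contra! hcon
    exact hk ⟨n, hn, hcon⟩
  filter_upwards [ae_eventually_notMem hout.ne, ae_all_iff.2 hlarge] with ω h1 h2
  rw [Metric.tendsto_atTop]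
  intro δ hδ
  -- Division by `C` absorbs the passage from `γ (2 ^ (k + 1))` to `γ n` when `2 ^ k ≤ n`.
  obtain ⟨q, hq⟩ := exists_nat_one_div_lt (div_pos hδ hC)
  obtain ⟨K, hK⟩ := eventually_atTop.1 (h1.and (h2 q))
  refine ⟨2 ^ K, fun n hn => ?_⟩
  have hn1 : 1 ≤ n := Nat.one_le_two_pow.trans hn
  set k := Nat.log 2 n with hk
  have hk1 : 2 ^ k ≤ n := Nat.pow_log_le_self 2 (by omega)
  have hk2 : n ≤ 2 ^ (k + 1) := (Nat.lt_pow_succ_log_self (by norm_num) n).le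
  have hKk : K ≤ k := (Nat.le_log_iff_pow_le (by norm_num) (by omega)).2 hn
  obtain ⟨hin, hsm⟩ := hK k hKk
  have heq : ∑ i ∈ T n, (∏ r, ε (idx i r) ω) * h (fun r => X (idx i r) ω)
      = ∑ i ∈ T n, (∏ r, ε (idx i r) ω) * f k (fun r => X (idx i r) ω) := by
    refine Finset.sum_congr rfl fun i hi => ?_
    have hiA : (fun r => X (idx i r) ω) ∈ A (k + 1) := by
      by_contra hcon
      exact hin ⟨i, hT.mono hk2 hi, hcon⟩
    rw [hf]
    simp only
    rw [Set.indicator_of_mem hiA]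
  have hγn : 0 < γ n := hγ.pos n hn1
  have hγk : γ (2 ^ (k + 1)) ≤ C * γ n := by
    rw [pow_succ, mul_comm]
    refine (hγ.doubling _ Nat.one_le_two_pow).trans ?_
    exact mul_le_mul_of_nonneg_left (hγ.mono _ _ Nat.one_le_two_pow hk1) hC.le
  rw [Real.dist_eq, sub_zero, heq, abs_mul, abs_of_pos (by positivity), one_div,
    inv_mul_lt_iff₀ hγn]
  calc _ < 1 / ((q : ℝ) + 1) * γ (2 ^ (k + 1)) := hsm n hk2
    _ ≤ δ / C * (C * γ n) := mul_le_mul hq.le hγk (hpos _).le (by positivity)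
    _ = γ n * δ := by field_simp

/-- Almost sure convergence of the normalized sums of squares implies summability of the tail
probabilities along dyadic sizes. -/
theorem IsSymmetrizedSample.tsum_measure_sum_sq_lt_top (hX : IsSymmetrizedSample P μ X ε)
    (hT : IsShiftIndexing idx T lev shift) {γ : ℕ → ℝ} {C : ℝ}
    (hγ : IsRegularNormalizer d γ C) {h : (Fin d → E) → ℝ} (hh : Measurable h)
    (hlim : ∀ᵐ ω ∂P, Tendsto (fun n : ℕ => 1 / γ n ^ 2 *
      ∑ i ∈ T n, h (fun r => X (idx i r) ω) ^ 2) atTop (𝓝 0)) {δ : ℝ} (hδ : 0 < δ) :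
    ∑' k : ℕ, P {ω | ENNReal.ofReal (δ * γ (2 ^ (k + 1)) ^ 2)
      < ∑ i ∈ T (2 ^ k), ENNReal.ofReal (h (fun r => X (idx i r) ω) ^ 2)} < ⊤ := by
  have hpos : ∀ k, 0 < γ (2 ^ k) := fun k => hγ.pos _ Nat.one_le_two_pow
  -- Translation by `2 ^ k` sends the levels in `[1, 2 ^ k]` into the block `(2 ^ k, 2 ^ (k + 1)]`,
  -- and the translated multi-indices lie in `T (2 ^ (k + 1))`. This is why a sum of size `2 ^ k` is
  -- paired with `γ (2 ^ (k + 1))`.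
  have hblock : ∀ k, ∀ i ∈ T (2 ^ k), ∀ r, 2 ^ k < lev (shift (2 ^ k) (idx i r)) ∧
      lev (shift (2 ^ k) (idx i r)) ≤ 2 ^ (k + 1) := by
    intro k i hi r
    have h1 := hT.one_le_lev _ i hi r
    have h2 := hT.lev_le _ i hi r
    rw [hT.lev_shift, pow_succ]
    omega
  set M : ∀ k, Set (DyadicBlock lev k → E) := fun k => {v |
    ENNReal.ofReal (δ * γ (2 ^ (k + 1)) ^ 2) < ∑ i ∈ (T (2 ^ k)).attach,
      ENNReal.ofReal (h (fun r => v ⟨shift (2 ^ k) (idx i r), hblock k i i.2 r⟩) ^ 2)} with hM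
  have hMm : ∀ k, MeasurableSet (M k) := fun k =>
    measurableSet_lt measurable_const (by fun_prop)
  have hiff : ∀ k ω, (fun p : DyadicBlock lev k => X p ω) ∈ M k ↔
      ENNReal.ofReal (δ * γ (2 ^ (k + 1)) ^ 2) < ∑ i ∈ T (2 ^ k),
      ENNReal.ofReal (h (fun r => X (shift (2 ^ k) (idx i r)) ω) ^ 2) := by
    intro k ω
    rw [← Finset.sum_attach]
    rfl
  have hev : ∀ᵐ ω ∂P, ∀ᶠ k in atTop, (fun p : DyadicBlock lev k => X p ω) ∉ M k := by
    filter_upwards [hlim] with ω hω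
    have ht : Tendsto (fun k : ℕ => 2 ^ (k + 1)) atTop atTop :=
      (tendsto_pow_atTop_atTop_of_one_lt (by norm_num : 1 < 2)).comp (tendsto_add_atTop_nat 1)
    filter_upwards [(hω.comp ht).eventually_lt_const hδ] with k hk
    rw [hiff, not_lt]
    simp only [Function.comp_apply] at hk
    rw [one_div, inv_mul_lt_iff₀ (pow_pos (hpos _) 2)] at hk
    calc ∑ i ∈ T (2 ^ k), ENNReal.ofReal (h (fun r => X (shift (2 ^ k) (idx i r)) ω) ^ 2)
        = ∑ i ∈ T (2 ^ k), ENNReal.ofReal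
            (h (fun r => X (idx (fun r => i r + 2 ^ k) r) ω) ^ 2) := by
          simp_rw [hT.idx_shift]
      _ = ∑ i ∈ (T (2 ^ k)).image fun i r => i r + 2 ^ k,
            ENNReal.ofReal (h (fun r => X (idx i r) ω) ^ 2) := by
          rw [Finset.sum_image]
          intro i _ i' _ hii
          funext r
          exact Nat.add_right_cancel (congrFun hii r)
      _ ≤ ∑ i ∈ T (2 ^ (k + 1)), ENNReal.ofReal (h (fun r => X (idx i r) ω) ^ 2) := by
          refine Finset.sum_le_sum_of_subset (Finset.image_subset_iff.2 fun i hi => ?_)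
          rw [pow_succ, mul_comm]
          exact hT.shift_mem _ i hi
      _ = ENNReal.ofReal (∑ i ∈ T (2 ^ (k + 1)), h (fun r => X (idx i r) ω) ^ 2) :=
          (ENNReal.ofReal_sum_of_nonneg fun i _ => sq_nonneg _).symm
      _ ≤ _ := ENNReal.ofReal_le_ofReal (by linarith)
  have hmain := hX.tsum_blocks_lt_top lev hMm hev
  refine lt_of_le_of_lt (le_of_eq (tsum_congr fun k => ?_)) hmain
  simp_rw [hiff]
  have hset : MeasurableSet {x : ι → E | ENNReal.ofReal (δ * γ (2 ^ (k + 1)) ^ 2)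
      < ∑ i ∈ T (2 ^ k), ENNReal.ofReal (h (fun r => x (idx i r)) ^ 2)} :=
    measurableSet_lt measurable_const (by fun_prop)
  -- The translated and original samples have the same law, so the block probabilities are those of
  -- the untranslated sums.
  have e1 := congrArg (· {x : ι → E | ENNReal.ofReal (δ * γ (2 ^ (k + 1)) ^ 2)
      < ∑ i ∈ T (2 ^ k), ENNReal.ofReal (h (fun r => x (idx i r)) ^ 2)})
    ((hX.map_comp_injective (f := id) Function.injective_id).trans
      (hX.map_comp_injective (hT.shift_injective (2 ^ k))).symm)
  rw [Measure.map_apply (measurable_pi_lambda _ fun k => hX.measurable_X _) hset,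
    Measure.map_apply (measurable_pi_lambda _ fun k => hX.measurable_X _) hset] at e1
  exact e1

theorem isShiftIndexing_simplex :
    IsShiftIndexing (fun (i : Fin d → ℕ) r => i r) (simplexIndices d) id (fun n j => j + n) := by
  have hmem : ∀ {n : ℕ} {i : Fin d → ℕ}, i ∈ simplexIndices d n ↔
      (∀ r, 1 ≤ i r ∧ i r ≤ n) ∧ StrictMono i := by
    intro n i
    simp [simplexIndices, cubeIndices]
  refine { tetrahedral := fun n => ⟨fun i hi => (hmem.1 hi).2.injective, fun i hi j hj hij => ?_⟩,
           mono := fun m n hmn i hi => ?_, lev_le := fun n i hi r => ((hmem.1 hi).1 r).2,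
           lt_lev := fun n i hi hni => ?_, card_le := fun n => ?_,
           one_le_lev := fun n i hi r => ((hmem.1 hi).1 r).1,
           shift_injective := fun n => add_left_injective n, lev_shift := fun n p => rfl,
           shift_mem := fun n i hi => ?_, idx_shift := fun n i r => rfl }
  · exact (StrictMono.range_inj (hmem.1 hi).2 (hmem.1 hj).2).1 hij
  · exact hmem.2 ⟨fun r => ⟨((hmem.1 hi).1 r).1, ((hmem.1 hi).1 r).2.trans hmn⟩, (hmem.1 hi).2⟩
  · by_contra! hcon
    exact hni (hmem.2 ⟨fun r => ⟨((hmem.1 hi).1 r).1, hcon r⟩, (hmem.1 hi).2⟩)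
  · refine (Finset.card_filter_le _ _).trans ?_
    simp [cubeIndices, Fintype.card_piFinset]
  · refine hmem.2 ⟨fun r => ?_, fun r r' hrr' => Nat.add_lt_add_right ((hmem.1 hi).2 hrr') n⟩
    have := (hmem.1 hi).1 r
    omega

theorem isShiftIndexing_cube :
    IsShiftIndexing (fun (i : Fin d → ℕ) r => (r, i r)) (cubeIndices d) Prod.snd
      (fun n (p : Fin d × ℕ) => (p.1, p.2 + n)) := by
  have hmem : ∀ {n : ℕ} {i : Fin d → ℕ}, i ∈ cubeIndices d n ↔ ∀ r, 1 ≤ i r ∧ i r ≤ n := by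
    intro n i
    simp [cubeIndices]
  refine { tetrahedral := fun n => ⟨fun i hi r r' h => congrArg Prod.fst h,
             fun i hi j hj hij => ?_⟩,
           mono := fun m n hmn i hi => ?_, lev_le := fun n i hi r => (hmem.1 hi r).2,
           lt_lev := fun n i hi hni => ?_, card_le := fun n => ?_,
           one_le_lev := fun n i hi r => (hmem.1 hi r).1,
           shift_injective := fun n p p' h => ?_, lev_shift := fun n p => rfl,
           shift_mem := fun n i hi => ?_, idx_shift := fun n i r => rfl }
  · funext r
    have h1 : (r, i r) ∈ Set.range fun r => (r, j r) := hij ▸ Set.mem_range_self r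
    obtain ⟨r', h'⟩ := h1
    simp only [Prod.mk.injEq] at h'
    obtain ⟨rfl, h'⟩ := h'
    exact h'.symm
  · exact hmem.2 fun r => ⟨(hmem.1 hi r).1, (hmem.1 hi r).2.trans hmn⟩
  · by_contra! hcon
    exact hni (hmem.2 fun r => ⟨(hmem.1 hi r).1, hcon r⟩)
  · simp [cubeIndices, Fintype.card_piFinset]
  · simp only [Prod.mk.injEq, add_left_inj] at h
    exact Prod.ext h.1 h.2
  · refine hmem.2 fun r => ?_
    have := hmem.1 hi r
    omega

end Indexing

/-! ### Series in the extended nonnegative reals -/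

section Summability

theorem ENNReal.tsum_lt_top_of_eventually_le {f g : ℕ → ENNReal} {c : ENNReal} (hc : c ≠ ⊤)
    (hg : ∑' k, g k < ⊤) (hf : ∀ k, f k ≠ ⊤) (hle : ∀ᶠ k in atTop, f k ≤ c * g k) :
    ∑' k, f k < ⊤ := by
  obtain ⟨m, hm⟩ := eventually_atTop.1 hle
  rw [← ENNReal.summable.sum_add_tsum_nat_add' (k := m)]
  refine ENNReal.add_lt_top.2 ⟨ENNReal.sum_lt_top.2 fun k _ => (hf k).lt_top, ?_⟩
  calc ∑' k, f (k + m) ≤ ∑' k, c * g (k + m) :=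
        ENNReal.tsum_le_tsum fun k => hm _ (Nat.le_add_left _ _)
    _ = c * ∑' k, g (k + m) := ENNReal.tsum_mul_left
    _ ≤ c * ∑' k, g k :=
        mul_le_mul_right (ENNReal.tsum_comp_le_tsum_of_injective (add_left_injective m) g) c
    _ < ⊤ := ENNReal.mul_lt_top hc.lt_top hg

/-- Abel-type bound by first entrance times: if the tails of the weights `w` are comparable with
their first terms, then `∑ w_j 1_{A_j}` is controlled by the first entrances in the `A_j`. -/
theorem tsum_mul_indicator_le {α : Type*} {w : ℕ → ENNReal} {c : ENNReal}
    (hw : ∀ l, ∑' k, w (l + k) ≤ c * w l) (A : ℕ → Set α) (G : α → ENNReal) (x : α) :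
    ∑' j, w j * (A j).indicator G x
      ≤ c * (w 0 * (A 0).indicator G x
        + ∑' j, w (j + 1) * (A (j + 1) \ A j).indicator G x) := by
  classical
  by_cases hx : ∃ j, x ∈ A j
  swap
  · have : ∀ j, (A j).indicator G x = 0 := fun j =>
      Set.indicator_of_notMem (fun h => hx ⟨j, h⟩) _
    simp [this]
  -- With `l` the first entrance time, the left side is at most the tail of `w` from `l` times `G
  -- x`, hence at most `c * w l * G x`; the right side keeps `c` times the entrance term. No
  -- monotonicity of `A` is needed.
  set l := Nat.find hx with hl
  have hl1 : x ∈ A l := Nat.find_spec hx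
  have hl2 : ∀ j < l, x ∉ A j := fun j hj => Nat.find_min hx hj
  have hsum : ∑' j, w j * (A j).indicator G x ≤ c * (w l * G x) := by
    rw [← ENNReal.summable.sum_add_tsum_nat_add' (k := l), Finset.sum_eq_zero, zero_add]
    · calc ∑' k, w (k + l) * (A (k + l)).indicator G x ≤ ∑' k, w (l + k) * G x := by
            refine ENNReal.tsum_le_tsum fun k => ?_
            rw [add_comm k l]
            exact mul_le_mul_right (Set.indicator_le_self' (fun _ _ => zero_le) _) _
        _ = (∑' k, w (l + k)) * G x := ENNReal.tsum_mul_right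
        _ ≤ c * w l * G x := mul_le_mul_left (hw l) _
        _ = _ := mul_assoc _ _ _
    · intro j hj
      rw [Set.indicator_of_notMem (hl2 j (Finset.mem_range.1 hj)), mul_zero]
  refine hsum.trans (mul_le_mul_right ?_ c)
  rcases hcase : l with _ | n
  · rw [hcase] at hl1
    rw [Set.indicator_of_mem hl1]
    exact le_self_add
  · rw [hcase] at hl1 hl2
    have hmem : x ∈ A (n + 1) \ A n := ⟨hl1, hl2 n n.lt_succ_self⟩
    refine le_trans ?_ le_add_self
    refine le_trans (le_of_eq ?_)
      (ENNReal.le_tsum (f := fun j => w (j + 1) * (A (j + 1) \ A j).indicator G x) n)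
    simp only [Set.indicator_of_mem hmem]

end Summability

/-! ### Summable truncated moments and the equivalence -/

section Main

variable {Ω E : Type*} [MeasurableSpace Ω] [MeasurableSpace E]
  {P : Measure Ω} {μ : Measure E} [IsProbabilityMeasure μ] {d : ℕ}
  {γ : ℕ → ℝ} {C : ℝ} {h : (Fin d → E) → ℝ}

theorem IsRegularNormalizer.const_pos (hγ : IsRegularNormalizer d γ C) : 0 < C :=
  pos_of_mul_pos_left ((hγ.pos (2 * 1) (by norm_num)).trans_le (hγ.doubling 1 le_rfl))
    (hγ.pos 1 le_rfl).le

/-- If the decoupled samples eventually stay in the truncation sets, in the summable sense, then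
the truncated second moments are summable. -/
theorem tsum_truncated_moment_lt_top (hd : 1 ≤ d) (hγ : IsRegularNormalizer d γ C)
    (hh : Measurable h)
    (hout : ∑' k : ℕ, decoupledLaw μ d {y | ∃ i ∈ cubeIndices d (2 ^ (k + 1)),
      evalTuple i y ∉ truncSet μ h γ (k + 1) d} < ⊤) :
    ∑' k : ℕ, ((2 : ENNReal) ^ (k + 1)) ^ d *
      ∫⁻ x, (ENNReal.ofReal (γ (2 ^ (k + 1)) ^ 2))⁻¹ * (truncSet μ h γ (k + 1) d).indicator
        (fun y => ENNReal.ofReal (h y ^ 2)) x ∂(Measure.pi fun _ => μ) < ⊤ := by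
  have hpos : ∀ k, 0 < γ (2 ^ k) := fun k => hγ.pos _ Nat.one_le_two_pow
  set A : ℕ → Set (Fin d → E) := fun k => truncSet μ h γ (k + 1) d with hAdef
  have hA : ∀ k, MeasurableSet (A k) := fun k => measurableSet_truncSet μ hh γ (k + 1) d
  set G : (Fin d → E) → ENNReal := fun y => ENNReal.ofReal (h y ^ 2) with hG
  have hGm : Measurable G := (hh.pow_const 2).ennreal_ofReal
  set w : ℕ → ENNReal := fun k => ((2 : ENNReal) ^ (k + 1)) ^ d
    * (ENNReal.ofReal (γ (2 ^ (k + 1)) ^ 2))⁻¹ with hwdef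
  have hw_real : ∀ k, w k = ENNReal.ofReal ((2 : ℝ) ^ (d * (k + 1)) / γ (2 ^ (k + 1)) ^ 2) := by
    intro k
    rw [ENNReal.ofReal_div_of_pos (pow_pos (hpos _) 2), ENNReal.ofReal_pow (by norm_num),
      ENNReal.ofReal_ofNat, mul_comm d, pow_mul, div_eq_mul_inv]
  have hw : ∀ l, ∑' k, w (l + k) ≤ ENNReal.ofReal C * w l := by
    intro l
    simp_rw [hw_real]
    rw [← ENNReal.ofReal_mul hγ.const_pos.le]
    have h1 := hγ.tail (l + 1) (Nat.le_add_left _ _)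
    have h2 := hγ.summable (l + 1) (Nat.le_add_left _ _)
    simp_rw [Nat.add_right_comm l 1] at h1 h2
    rw [← ENNReal.ofReal_tsum_of_nonneg (fun k => by positivity) h2]
    exact ENNReal.ofReal_le_ofReal h1
  -- Here `A k` is the truncation set of level `k + 1`. The size is `2 ^ (k + 1)` although the
  -- truncation level is `k + 2`, so that a visit to `A (k + 1) \ A k` is an exit from `A k` by a
  -- sample of the size occurring in `hout`.
  set m : ℕ → ENNReal := fun k => ((2 ^ (k + 1) : ℕ) : ENNReal) ^ d *
    ∫⁻ x, (ENNReal.ofReal (γ (2 ^ (k + 1 + 1)) ^ 2))⁻¹ * (A (k + 1) \ A k).indicator G x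
      ∂(Measure.pi fun _ => μ) with hmdef
  have hmk : ∀ k, m k ≠ ⊤ ∧ m k ≤ 4 * (m k + 2 ^ d) * decoupledLaw μ d
      {y | ∃ i ∈ cubeIndices d (2 ^ (k + 1)), evalTuple i y ∈ A (k + 1) \ A k} := fun k =>
    pow_mul_lintegral_indicator_le μ hd hh (hpos (k + 1 + 1)) (by positivity)
      (Nat.pow_le_pow_right (by norm_num) (Nat.le_succ _)) ((hA _).diff (hA _))
      Set.sdiff_subset rfl
  have hmsum : ∑' k, m k < ⊤ := by
    refine ENNReal.tsum_lt_top_of_eventually_le (c := 8 * 2 ^ d) (by finiteness) hout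
      (fun k => (hmk k).1) ?_
    have hlim := ENNReal.tendsto_atTop_zero_of_tsum_ne_top hout.ne
    -- Once the exit probability `p` is at most `1 / 8`, the inequality `m ≤ 4 (m + 2 ^ d) p` gives
    -- `m ≤ m / 2 + 4 * 2 ^ d * p`, that is `m ≤ 8 * 2 ^ d * p`.
    filter_upwards [hlim.eventually_lt_const (show (0 : ENNReal) < 8⁻¹ by simp)] with k hk
    set p := decoupledLaw μ d {y | ∃ i ∈ cubeIndices d (2 ^ (k + 1)),
      evalTuple i y ∉ truncSet μ h γ (k + 1) d}
    obtain ⟨hmt, hmle⟩ := hmk k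
    have hmle' : m k ≤ 4 * (m k + 2 ^ d) * p := by
      refine hmle.trans (mul_le_mul_right (measure_mono ?_) _)
      rintro y ⟨i, hi, hy⟩
      exact ⟨i, hi, hy.2⟩
    have hpt : p ≠ ⊤ := measure_ne_top _ _
    have hp8 : p.toReal ≤ 1 / 8 := by
      have := ENNReal.toReal_mono (by simp) hk.le
      simpa using this
    clear hmle
    generalize m k = q at hmt hmle' ⊢
    rw [← ENNReal.toReal_le_toReal hmt (by finiteness)] at hmle' ⊢
    rw [ENNReal.toReal_mul, ENNReal.toReal_mul, ENNReal.toReal_add hmt (by finiteness)] at hmle'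
    rw [ENNReal.toReal_mul, ENNReal.toReal_mul]
    simp only [ENNReal.toReal_pow, ENNReal.toReal_ofNat] at hmle' ⊢
    nlinarith [mul_le_mul_of_nonneg_left hp8 (ENNReal.toReal_nonneg (a := q))]
  have hind : ∀ B : Set (Fin d → E), MeasurableSet B → Measurable (B.indicator G) :=
    fun B hB => hGm.indicator hB
  have hfirst : w 0 * ∫⁻ x, (A 0).indicator G x ∂(Measure.pi fun _ => μ) < ⊤ := by
    have h1 : ∀ x, (ENNReal.ofReal (γ (2 ^ 1) ^ 2))⁻¹ * (A 0).indicator G x ≤ 1 := by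
      intro x
      have := pow_mul_lmarginal_indicator_le μ hh (hpos 1) le_rfl (hA 0) subset_rfl
        (K := ∅) (by rw [Finset.card_empty]; omega) x
      simpa using this
    have h2 : w 0 * ∫⁻ x, (A 0).indicator G x ∂(Measure.pi fun _ => μ)
        = ((2 : ENNReal) ^ (0 + 1)) ^ d * ∫⁻ x, (ENNReal.ofReal (γ (2 ^ 1) ^ 2))⁻¹
          * (A 0).indicator G x ∂(Measure.pi fun _ => μ) := by
      rw [lintegral_const_mul _ (hind _ (hA 0)), ← mul_assoc]
    rw [h2]
    refine ENNReal.mul_lt_top (by finiteness) ?_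
    refine lt_of_le_of_lt (lintegral_mono h1) ?_
    simp
  -- The factor `2 ^ d` repairs the mismatch between size `2 ^ (j + 1)` in `m j` and weight index `j
  -- + 2`.
  have hterm : ∀ j, w (j + 1) * ∫⁻ x, (A (j + 1) \ A j).indicator G x ∂(Measure.pi fun _ => μ)
      = 2 ^ d * m j := by
    intro j
    rw [hmdef]
    simp only
    rw [lintegral_const_mul _ (hind _ ((hA _).diff (hA _)))]
    push_cast
    rw [hwdef]
    simp only
    rw [pow_succ (2 : ENNReal) (j + 1), mul_pow]
    ring
  calc ∑' k : ℕ, ((2 : ENNReal) ^ (k + 1)) ^ d *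
      ∫⁻ x, (ENNReal.ofReal (γ (2 ^ (k + 1)) ^ 2))⁻¹ * (A k).indicator G x
        ∂(Measure.pi fun _ => μ)
      = ∑' k, ∫⁻ x, w k * (A k).indicator G x ∂(Measure.pi fun _ => μ) := by
        refine tsum_congr fun k => ?_
        rw [lintegral_const_mul _ (hind _ (hA k)), lintegral_const_mul _ (hind _ (hA k)),
          ← mul_assoc]
    _ = ∫⁻ x, ∑' k, w k * (A k).indicator G x ∂(Measure.pi fun _ => μ) :=
        (lintegral_tsum fun k => (measurable_const.mul (hind _ (hA k))).aemeasurable).symm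
    _ ≤ ∫⁻ x, ENNReal.ofReal C * (w 0 * (A 0).indicator G x
        + ∑' j, w (j + 1) * (A (j + 1) \ A j).indicator G x) ∂(Measure.pi fun _ => μ) :=
        lintegral_mono fun x => tsum_mul_indicator_le hw A G x
    _ = ENNReal.ofReal C * (w 0 * ∫⁻ x, (A 0).indicator G x ∂(Measure.pi fun _ => μ)
        + ∑' j, w (j + 1) * ∫⁻ x, (A (j + 1) \ A j).indicator G x ∂(Measure.pi fun _ => μ)) := by
        have hm1 : ∀ j, Measurable fun x => w (j + 1) * (A (j + 1) \ A j).indicator G x :=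
          fun j => measurable_const.mul (hind _ ((hA _).diff (hA _)))
        have hm2 : Measurable fun x => w 0 * (A 0).indicator G x :=
          measurable_const.mul (hind _ (hA 0))
        have hm3 : Measurable fun x => w 0 * (A 0).indicator G x
            + ∑' j, w (j + 1) * (A (j + 1) \ A j).indicator G x :=
          hm2.add (Measurable.tsum hm1)
        rw [lintegral_const_mul _ hm3,
          lintegral_add_left hm2, lintegral_const_mul _ (hind _ (hA 0)),
          lintegral_tsum fun j => (hm1 j).aemeasurable]
        congr 2
        exact tsum_congr fun j => lintegral_const_mul _ (hind _ ((hA _).diff (hA _)))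
    _ < ⊤ := by
        simp_rw [hterm]
        rw [ENNReal.tsum_mul_left]
        exact ENNReal.mul_lt_top ENNReal.ofReal_lt_top
          (ENNReal.add_lt_top.2 ⟨hfirst, ENNReal.mul_lt_top (by finiteness) hmsum⟩)

variable {Y : ℕ → Ω → E} {η : ℕ → Ω → ℝ}

/-- Cutting the cube into `2 ^ (s d)` cubes of side `2 ^ (k - s)` leaves room to place `d` disjoint
blocks of that size inside `2 ^ k`. Both samples then have the same size, at the price of a constant
in the threshold and in the probability. -/
theorem IsSymmetrizedSample.decoupledLaw_dyadic_le (hY : IsSymmetrizedSample P μ Y η)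
    {F : (Fin d → E) → ENNReal} (hF : Measurable F) {s k : ℕ} (hs : 2 * d ≤ 2 ^ s) (hsk : s ≤ k)
    (t : ENNReal) :
    decoupledLaw μ d {y | ((2 ^ s : ℕ) : ENNReal) ^ d * t
        < ∑ i ∈ cubeIndices d (2 ^ k), F (evalTuple i y)}
      ≤ ((2 ^ s : ℕ) : ENNReal) ^ d
        * P {ω | t < ∑ i ∈ simplexIndices d (2 ^ k), F fun r => Y (i r) ω} := by
  have hk : 2 ^ k = 2 ^ s * 2 ^ (k - s) := by rw [← pow_add, Nat.add_sub_cancel' hsk]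
  have h1 : 1 ≤ 2 ^ (k - s) := Nat.one_le_two_pow
  have hN : d * (2 ^ (k - s) + 1) ≤ 2 ^ k := by
    calc d * (2 ^ (k - s) + 1) ≤ d * (2 * 2 ^ (k - s)) := Nat.mul_le_mul_left _ (by omega)
      _ = 2 * d * 2 ^ (k - s) := by ring
      _ ≤ 2 ^ s * 2 ^ (k - s) := Nat.mul_le_mul_right _ hs
      _ = 2 ^ k := hk.symm
  calc _ ≤ ((2 ^ s : ℕ) : ENNReal) ^ d * decoupledLaw μ d
        {y | t < ∑ i ∈ cubeIndices d (2 ^ (k - s)), F (evalTuple i y)} := by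
        rw [hk]
        exact decoupledLaw_sum_mul_le hF (2 ^ s) (2 ^ (k - s)) t
    _ ≤ _ := mul_le_mul_right (hY.decoupledLaw_sum_le hF hN t) _

/-- Up to constants, the decoupled samples leave the truncation sets not more often than the
undecoupled ones. -/
theorem IsSymmetrizedSample.tsum_decoupledLaw_lt_top [IsProbabilityMeasure P] (hY : IsSymmetrizedSample P μ Y η)
    {A : ℕ → Set (Fin d → E)} (hA : ∀ k, MeasurableSet (A k))
    (hout : ∑' k : ℕ, P {ω | ∃ i ∈ simplexIndices d (2 ^ (k + 1)),
      (fun r => Y (i r) ω) ∉ A (k + 1)} < ⊤) :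
    ∑' k : ℕ, decoupledLaw μ d {y | ∃ i ∈ cubeIndices d (2 ^ (k + 1)),
      evalTuple i y ∉ A (k + 1)} < ⊤ := by
  obtain ⟨s, hs⟩ : ∃ s, 2 * d ≤ 2 ^ s := ⟨2 * d, Nat.lt_two_pow_self.le⟩
  refine ENNReal.tsum_lt_top_of_eventually_le (c := ((2 ^ s : ℕ) : ENNReal) ^ d) (by finiteness)
    hout (fun k => measure_ne_top _ _) (eventually_atTop.2 ⟨s, fun k hk => ?_⟩)
  -- An exit is positivity of a sum of indicators; at threshold `0` the comparison of tails loses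
  -- nothing in the threshold.
  have hpos : ∀ (T : Finset (Fin d → ℕ)) (x : (Fin d → ℕ) → Fin d → E),
      (∃ i ∈ T, x i ∉ A (k + 1))
        ↔ 0 < ∑ i ∈ T, (A (k + 1))ᶜ.indicator (1 : (Fin d → E) → ENNReal) (x i) := by
    intro T x
    rw [pos_iff_ne_zero, Ne, Finset.sum_eq_zero_iff]
    simp
  have := hY.decoupledLaw_dyadic_le (F := (A (k + 1))ᶜ.indicator 1)
    (measurable_one.indicator (hA _).compl) hs (k := k + 1) (by omega) 0
  rw [mul_zero] at this
  convert this using 3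
  · ext y
    exact hpos _ fun i => evalTuple i y
  · ext ω
    exact hpos _ fun i r => Y (i r) ω

theorem IsSymmetrizedSample.measure_decoupled_eq {X : Fin d → ℕ → Ω → E}
    {ε : Fin d → ℕ → Ω → ℝ} (hX : IsSymmetrizedSample P μ (fun p : Fin d × ℕ => X p.1 p.2)
      (fun p : Fin d × ℕ => ε p.1 p.2)) {S : Set (Fin d → ℕ → E)} (hS : MeasurableSet S) :
    P {ω | (fun r j => X r j ω) ∈ S} = decoupledLaw μ d S := by
  rw [← hX.map_decoupled (f := id) Function.injective_id]
  exact (Measure.map_apply (measurable_pi_lambda _ fun r => measurable_pi_lambda _ fun j =>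
    hX.measurable_X (r, j)) hS).symm

theorem measurableSet_exists_evalTuple_notMem {A : Set (Fin d → E)} (hA : MeasurableSet A)
    (T : Finset (Fin d → ℕ)) : MeasurableSet {y | ∃ i ∈ T, evalTuple i y ∉ A} := by
  have : {y | ∃ i ∈ T, evalTuple i y ∉ A} = ⋃ i ∈ T, evalTuple i ⁻¹' Aᶜ := by
    ext y
    simp
  rw [this]
  exact Finset.measurableSet_biUnion _ fun i _ => measurable_evalTuple i hA.compl

/-- Comparison of two consecutive dyadic normalizations. -/
theorem IsRegularNormalizer.sq_two_pow_succ_le (hγ : IsRegularNormalizer d γ C) (k : ℕ) :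
    γ (2 ^ (k + 1)) ^ 2 ≤ C ^ 2 * γ (2 ^ k) ^ 2 := by
  have h1 : 1 ≤ 2 ^ k := Nat.one_le_two_pow
  rw [← mul_pow, pow_succ' 2 k]
  exact pow_le_pow_left₀ (hγ.pos _ (by omega)).le (hγ.doubling _ h1) 2

end Main

theorem theorem2 {Ω E : Type*} [MeasurableSpace Ω] [MeasurableSpace E]
    (P : Measure Ω) [IsProbabilityMeasure P] (μ : Measure E) [IsProbabilityMeasure μ]
    (d : ℕ) (hd : 1 ≤ d) (γ : ℕ → ℝ) (C : ℝ) (hγ : IsRegularNormalizer d γ C)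
    (h : (Fin d → E) → ℝ) (h_meas : Measurable h)
    (h_symm : ∀ (σ : Equiv.Perm (Fin d)) (x : Fin d → E), h (fun r => x (σ r)) = h x)
    -- the variables `X_j`, `ε_j`
    (X : ℕ → Ω → E) (ε : ℕ → Ω → ℝ) (hX : IsSymmetrizedSample P μ X ε)
    -- the decoupled variables `X_j^{(r)}`, `ε_j^{(r)}`
    (X' : Fin d → ℕ → Ω → E) (ε' : Fin d → ℕ → Ω → ℝ)
    (hX' : IsSymmetrizedSample P μ (fun p : Fin d × ℕ => X' p.1 p.2)
      (fun p : Fin d × ℕ => ε' p.1 p.2)) :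
    List.TFAE [
      ∀ᵐ ω ∂P, Tendsto (fun n : ℕ => 1 / γ n *
        ∑ i ∈ simplexIndices d n, (∏ r, ε (i r) ω) * h (fun r => X (i r) ω)) atTop (𝓝 0),
      ∀ᵐ ω ∂P, Tendsto (fun n : ℕ => 1 / γ n *
        ∑ i ∈ cubeIndices d n, (∏ r, ε' r (i r) ω) * h (fun r => X' r (i r) ω)) atTop (𝓝 0),
      ∀ᵐ ω ∂P, Tendsto (fun n : ℕ => 1 / γ n ^ 2 *
        ∑ i ∈ simplexIndices d n, h (fun r => X (i r) ω) ^ 2) atTop (𝓝 0),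
      ∀ᵐ ω ∂P, Tendsto (fun n : ℕ => 1 / γ n ^ 2 *
        ∑ i ∈ cubeIndices d n, h (fun r => X' r (i r) ω) ^ 2) atTop (𝓝 0),
      ∑' k : ℕ, P {ω | ∃ i ∈ simplexIndices d (2 ^ (k + 1)),
        (fun r => X (i r) ω) ∉ truncSet μ h γ (k + 1) d} < ⊤,
      ∑' k : ℕ, P {ω | ∃ i ∈ cubeIndices d (2 ^ (k + 1)),
        (fun r => X' r (i r) ω) ∉ truncSet μ h γ (k + 1) d} < ⊤] := by
  have hpos : ∀ k, 0 < γ (2 ^ k) := fun k => hγ.pos _ Nat.one_le_two_pow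
  have hC := hγ.const_pos
  have hA : ∀ k, MeasurableSet (truncSet μ h γ k d) := fun k => measurableSet_truncSet μ h_meas γ k d
  have hGm : Measurable fun x => ENNReal.ofReal (h x ^ 2) := (h_meas.pow_const 2).ennreal_ofReal
  have hsimplex := isShiftIndexing_simplex (d := d)
  have hcube := isShiftIndexing_cube (d := d)
  have hdec : ∀ k, P {ω | ∃ i ∈ cubeIndices d (2 ^ (k + 1)),
      (fun r => X' r (i r) ω) ∉ truncSet μ h γ (k + 1) d}
      = decoupledLaw μ d {y | ∃ i ∈ cubeIndices d (2 ^ (k + 1)),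
        evalTuple i y ∉ truncSet μ h γ (k + 1) d} := fun k =>
    hX'.measure_decoupled_eq (measurableSet_exists_evalTuple_notMem (hA _) _)
  -- The factor `M` is the loss in decoupling and `C ^ 2` the loss from one dyadic step of `γ`. The
  -- 4 leaves `γ² / 4`, strictly below the required `γ² / 2`.
  have hlt : ∀ (M : ℝ) (_ : 0 < M) (k : ℕ),
      ENNReal.ofReal M * ENNReal.ofReal ((4 * C ^ 2 * M)⁻¹ * γ (2 ^ (k + 1 + 1)) ^ 2)
        < ENNReal.ofReal (γ (2 ^ (k + 1)) ^ 2) / 2 := by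
    intro M hM k
    have h1 := hγ.sq_two_pow_succ_le (k + 1)
    have h2 := pow_pos (hpos (k + 1)) 2
    rw [← ENNReal.ofReal_mul hM.le, ← ENNReal.ofReal_ofNat, ← ENNReal.ofReal_div_of_pos two_pos,
      ENNReal.ofReal_lt_ofReal_iff (by positivity)]
    calc M * ((4 * C ^ 2 * M)⁻¹ * γ (2 ^ (k + 1 + 1)) ^ 2)
        ≤ M * ((4 * C ^ 2 * M)⁻¹ * (C ^ 2 * γ (2 ^ (k + 1)) ^ 2)) := by gcongr
      _ = γ (2 ^ (k + 1)) ^ 2 / 4 := by field_simp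
      _ < γ (2 ^ (k + 1)) ^ 2 / 2 := by linarith
  tfae_have 1 → 3 := fun H => hX.ae_tendsto_sq hsimplex.tetrahedral h_meas γ H
  tfae_have 2 → 4 := fun H => hX'.ae_tendsto_sq hcube.tetrahedral h_meas γ H
  tfae_have 3 → 6 := by
    intro H
    obtain ⟨s, hs⟩ : ∃ s, 2 * d ≤ 2 ^ s := ⟨2 * d, Nat.lt_two_pow_self.le⟩
    set M : ℝ := ((2 ^ s : ℕ) : ℝ) ^ d with hM
    have hM0 : 0 < M := by positivity
    have hME : ENNReal.ofReal M = ((2 ^ s : ℕ) : ENNReal) ^ d := by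
      rw [hM, ENNReal.ofReal_pow (Nat.cast_nonneg _), ENNReal.ofReal_natCast]
    have h3 := hX.tsum_measure_sum_sq_lt_top hsimplex hγ h_meas H
      (δ := (4 * C ^ 2 * M)⁻¹) (by positivity)
    -- The series starts with sums of size `2 ^ 0`; dropping that term aligns it with truncation
    -- levels starting at 1.
    have h3' := lt_of_le_of_lt (ENNReal.tsum_comp_le_tsum_of_injective (add_left_injective 1) _) h3
    refine ENNReal.tsum_lt_top_of_eventually_le
      (c := 2 ^ d * (4 * (1 + 2 ^ d)) * ((2 ^ s : ℕ) : ENNReal) ^ d) (by finiteness) h3'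
      (fun k => measure_ne_top _ _) (eventually_atTop.2 ⟨s, fun k hk => ?_⟩)
    rw [hdec]
    refine (decoupledLaw_exists_notMem_truncSet_le μ h_meas (hpos (k + 1))).trans ?_
    rw [mul_assoc (2 ^ d * (4 * (1 + 2 ^ d)))]
    refine mul_le_mul_right (le_trans (measure_mono fun y hy => ?_)
      (hX.decoupledLaw_dyadic_le hGm hs (k := k + 1) (by omega)
        (ENNReal.ofReal ((4 * C ^ 2 * M)⁻¹ * γ (2 ^ (k + 1 + 1)) ^ 2)))) _
    have := hlt M hM0 k
    rw [hME] at this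
    exact this.trans_le hy
  tfae_have 4 → 6 := by
    intro H
    have h4 := hX'.tsum_measure_sum_sq_lt_top hcube hγ h_meas H
      (δ := (4 * C ^ 2 * 1)⁻¹) (by positivity)
    have h4' := lt_of_le_of_lt (ENNReal.tsum_comp_le_tsum_of_injective (add_left_injective 1) _) h4
    refine ENNReal.tsum_lt_top_of_eventually_le
      (c := 2 ^ d * (4 * (1 + 2 ^ d))) (by finiteness) h4'
      (fun k => measure_ne_top _ _) (Eventually.of_forall fun k => ?_)
    rw [hdec]
    refine (decoupledLaw_exists_notMem_truncSet_le μ h_meas (hpos (k + 1))).trans ?_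
    refine mul_le_mul_right ?_ _
    rw [← hX'.measure_decoupled_eq (measurableSet_le measurable_const (by fun_prop))]
    refine measure_mono fun ω hω => ?_
    have := hlt 1 one_pos k
    rw [ENNReal.ofReal_one, one_mul] at this
    exact this.trans_le hω
  tfae_have 6 → 5 := by
    intro H
    refine ENNReal.tsum_lt_top_of_eventually_le (c := (d : ENNReal) ^ d) (by finiteness) H
      (fun k => measure_ne_top _ _) (Eventually.of_forall fun k => ?_)
    rw [hdec]
    exact hX.measure_exists_mem_le hd (hA (k + 1)).compl _
  tfae_have 5 → 1 := by
    intro H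
    -- The exits of the coupled sample serve directly; only the moment bound needs the decoupled
    -- exits, obtained from them by embedding.
    exact hX.ae_tendsto_of_truncation hsimplex hγ h_meas hA H
      (tsum_truncated_moment_lt_top hd hγ h_meas (hX.tsum_decoupledLaw_lt_top hA H))
  tfae_have 6 → 2 := by
    intro H
    refine hX'.ae_tendsto_of_truncation hcube hγ h_meas hA H
      (tsum_truncated_moment_lt_top hd hγ h_meas ?_)
    simpa only [hdec] using H
  tfae_finish
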